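/- Let $t\ge 1$ be an integer. For a finite simple graph $G$, let $\lambda(G)$ be the spectral radius of its adjacency matrix. Let $C_{4,4,\ldots,4}$ be the graph on $3t+1$ vertices formed by $t$ four-cycles that all share one common vertex and are otherwise pairwise vertex-disjoint. For $n\ge t$ let $F_{n,t}=K_t\vee M_{n-t}$ be the join of the complete graph $K_t$ with $M_{n-t}=\lfloor\frac{n-t}{2}\rfloor K_2\cup\gamma K_1$, where $\gamma\in\{0,1\}$ and $\gamma\equiv n-t\pmod 2$ (a maximal matching on $n-t$ vertices). Then there is $N=N(t)$ such that for every $n\ge N$ the following hold: $F_{n,t}$ does not contain $C_{4,4,\ldots,4}$ as a (not necessarily induced) subgraph; and every $n$-vertex graph $G$ with $\lambda(G)\ge\lambda(F_{n,t})$ that is not isomorphic to $F_{n,t}$ contains $C_{4,4,\ldots,4}$ as a (not necessarily induced) subgraph. -/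

import Mathlib

namespace SpectralTuran

/-- The join `G ∨ H`: the disjoint union of `G` and `H` together with all edges between them. -/
def join {V W : Type*} (G : SimpleGraph V) (H : SimpleGraph W) : SimpleGraph (V ⊕ W) :=
  (G ⊕g H) ⊔ completeBipartiteGraph V W

/-- The maximal matching `M_m` on the vertices `0, …, m - 1`: its edges are the pairs
`{2i, 2i + 1}`, and the last vertex is isolated when `m` is odd. -/
def maxMatching (m : ℕ) : SimpleGraph (Fin m) where
  Adj u v := u ≠ v ∧ (u : ℕ) / 2 = (v : ℕ) / 2
  symm := ⟨fun _ _ h => ⟨h.1.symm, h.2.symm⟩⟩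
  loopless := ⟨fun _ h => h.1 rfl⟩

/-- The graph `F_{n,t} = K_t ∨ M_{n-t}`; it has `n` vertices whenever `t ≤ n`. -/
def extremalGraph (n t : ℕ) : SimpleGraph (Fin t ⊕ Fin (n - t)) :=
  join (⊤ : SimpleGraph (Fin t)) (maxMatching (n - t))

/-- The graph `C_{4,4,…,4}`: `t` four-cycles sharing exactly one vertex, which is `none`.
The `i`-th cycle is `none, (i, 0), (i, 1), (i, 2), none`. -/
def intersectingFourCycles (t : ℕ) : SimpleGraph (Option (Fin t × Fin 3)) :=
  SimpleGraph.fromRel fun u v =>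
    match u, v with
    | none, none => False
    | none, some (_, j) => (j : ℕ) = 0
    | some (i, j), some (i', j') => i = i' ∧ (j' : ℕ) = (j : ℕ) + 1
    | some (_, j), none => (j : ℕ) = 2

open Classical in
/-- The spectral radius `λ(G)` of the adjacency matrix of a finite graph. The matrix is real and
symmetric, so all of its eigenvalues are real, and the largest absolute value of an eigenvalue
is taken over the real spectrum. -/
noncomputable def adjSpectralRadius {V : Type*} [Fintype V] (G : SimpleGraph V) : ENNReal :=
  spectralRadius ℝ (G.adjMatrix ℝ)

end SpectralTuran

/-!
Let `G` be an `n`-vertex graph without `t` intersecting four-cycles whose spectral radius `ρ` is at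
least that of `F = K_t ∨ M_{n-t}`, and let `x` be its Perron vector, scaled to maximum `1`. Since
`F` contains `K_{t,n-t}`, `ρ ^ 2 ≥ t (n - t)`. The idea is to locate `t` vertices of weight at least
`1 / 2` that are adjacent to almost everything, and then to compare `G` with `F` directly.

Locally, a maximal packing of four-cycles through a vertex `u` gives a set of at most `3 t + 1`
vertices outside of which every vertex has at most one common neighbour with `u`
(`exists_hitting_set`). So walks of length two from `u` reach most vertices at most once
(`exists_two_walk_bound`). Moreover there is no large `K_{t+1,m}`, so only boundedly many vertices
have linear degree (`card_large_degree_lt`), and all but boundedly many vertices see at most `t`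
of them.

For `t ≥ 2` the identity `ρ ^ 2 * x u = ∑ x y`, summed over the walks of length two from `u` to
some `y`, then shows that vertices of small degree have small weight, and that almost every
neighbour of a maximum of `x` has `t` neighbours of linear degree and weight almost `1`. Each of
these is adjacent to almost everything (`exists_large_vertices`).

For `t = 1` this fails, since polarity graphs have nearly the same spectral radius as `F`; a finer
argument is needed. In a four-cycle-free graph the numbers `deficit G x u v` measure how far
`(ρ ^ 2 - ρ) * x u` falls short of `n - 1`, and for a maximum `z` of `x` they add up to at most
`1 / ρ`. If `z` is not adjacent to all other vertices, this makes `x` nearly constant and almost all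
codegrees equal to one, and one ends either with an average degree that is too small or with a
regular friendship graph, which does not exist (`nonNbr_max_eq_empty`,
`not_friendship_of_regular`).

Given the `t` large vertices, the others span almost no Perron weight among themselves
(`sum_nbr_outside_le`). Hence deleting the edges between the other vertices at each vertex that
misses one of the large vertices, and joining it to all of them instead, increases `xᵀ A x`. As the
result is a subgraph of `F`, the assumption on `ρ` forces `G` to be `F`
(`nonempty_iso_of_large_vertices`).
-/

namespace SpectralTuran

open Finset

/-! ### Perron's theorem for graphs -/

section Perron

variable {V : Type*} [Fintype V]

open Classical in
/-- The neighbours of `v` in `G`, as a finset (with classical decidability throughout). -/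
noncomputable def nbr (G : SimpleGraph V) (v : V) : Finset V := univ.filter (G.Adj v)

@[simp] lemma mem_nbr {G : SimpleGraph V} {v w : V} : w ∈ nbr G v ↔ G.Adj v w := by
  simp [nbr]

/-- The adjacency operator: `(A x)_u` is the sum of `x` over the neighbours of `u`. -/
noncomputable def nbrSum (G : SimpleGraph V) (x : V → ℝ) (u : V) : ℝ := ∑ v ∈ nbr G u, x v

open Classical in
lemma nbrSum_eq_sum_ite (G : SimpleGraph V) (x : V → ℝ) (u : V) :
    nbrSum G x u = ∑ v, if G.Adj u v then x v else 0 := by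
  rw [nbrSum, nbr, sum_filter]

open Classical in
lemma sum_mul_nbrSum_comm (G : SimpleGraph V) (x y : V → ℝ) :
    ∑ u, y u * nbrSum G x u = ∑ u, x u * nbrSum G y u := by
  simp only [nbrSum_eq_sum_ite, mul_sum]
  rw [sum_comm]
  refine sum_congr rfl fun u _ => sum_congr rfl fun v _ => ?_
  by_cases h : G.Adj u v
  · simp [h, h.symm, mul_comm]
  · have h' : ¬ G.Adj v u := fun k => h k.symm
    simp [h, h']

/-- The quadratic form `xᵀ A x` of the adjacency matrix. -/
noncomputable def quad (G : SimpleGraph V) (x : V → ℝ) : ℝ := ∑ u, x u * nbrSum G x u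

lemma nbrSum_add_smul (G : SimpleGraph V) (x y : V → ℝ) (s : ℝ) (u : V) :
    nbrSum G (fun v => x v + s * y v) u = nbrSum G x u + s * nbrSum G y u := by
  simp [nbrSum, sum_add_distrib, mul_sum]

lemma quad_add_smul (G : SimpleGraph V) (x y : V → ℝ) (s : ℝ) :
    quad G (fun v => x v + s * y v)
      = quad G x + 2 * s * ∑ u, y u * nbrSum G x u + s ^ 2 * quad G y := by
  have h := sum_mul_nbrSum_comm G y x
  simp only [quad, nbrSum_add_smul, add_mul, mul_add, sum_add_distrib]
  have e1 : ∑ u, x u * (s * nbrSum G y u) = s * ∑ u, y u * nbrSum G x u := by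
    rw [← h, mul_sum]; exact sum_congr rfl fun u _ => by ring
  have e2 : ∑ u, s * y u * nbrSum G x u = s * ∑ u, y u * nbrSum G x u := by
    rw [mul_sum]; exact sum_congr rfl fun u _ => by ring
  have e3 : ∑ u, s * y u * (s * nbrSum G y u) = s ^ 2 * ∑ u, y u * nbrSum G y u := by
    rw [mul_sum]; exact sum_congr rfl fun u _ => by ring
  rw [e1, e2, e3]; ring

lemma sum_add_smul_sq (x y : V → ℝ) (s : ℝ) :
    ∑ u, (x u + s * y u) ^ 2 = ∑ u, x u ^ 2 + 2 * s * ∑ u, y u * x u + s ^ 2 * ∑ u, y u ^ 2 := by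
  simp only [mul_sum, ← sum_add_distrib]
  exact sum_congr rfl fun u _ => by ring

/-- A vector attaining the maximum `ρ` of the Rayleigh quotient is an eigenvector: the first
variation in the direction of the residual `ρ x - A x` vanishes. -/
lemma nbrSum_eq_of_quad_eq {G : SimpleGraph V} {ρ : ℝ} {x : V → ℝ}
    (hρ : ∀ y, quad G y ≤ ρ * ∑ u, y u ^ 2) (hx : quad G x = ρ * ∑ u, x u ^ 2) (u : V) :
    nbrSum G x u = ρ * x u := by
  set r : V → ℝ := fun u => ρ * x u - nbrSum G x u with hr
  set R := ∑ u, r u ^ 2 with hR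
  set c := ρ * ∑ u, r u ^ 2 - quad G r with hc
  have hc0 : 0 ≤ c := sub_nonneg.2 (hρ r)
  have hR0 : 0 ≤ R := sum_nonneg fun u _ => sq_nonneg _
  have key : ∀ s : ℝ, 0 ≤ 2 * s * R + s ^ 2 * c := by
    intro s
    have h := hρ (fun v => x v + s * r v)
    rw [quad_add_smul, sum_add_smul_sq, hx] at h
    have e : R = ρ * ∑ u, r u * x u - ∑ u, r u * nbrSum G x u := by
      rw [hR, mul_sum, ← sum_sub_distrib]
      exact sum_congr rfl fun u _ => by simp only [hr]; ring
    rw [e, hc]; nlinarith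
  -- a nonnegative quadratic in `s` without constant term has no linear term
  have hR' : R = 0 := by
    have h := key (-(R / (c + 1)))
    have hc1 : 0 < c + 1 := by linarith
    have e : 2 * -(R / (c + 1)) * R + (-(R / (c + 1))) ^ 2 * c
        = -(R ^ 2 * (c + 2)) / (c + 1) ^ 2 := by field_simp; ring
    rw [e, le_div_iff₀ (by positivity)] at h
    have : 0 ≤ R ^ 2 := sq_nonneg R
    have h2 : R ^ 2 = 0 := by nlinarith
    exact pow_eq_zero_iff (two_ne_zero) |>.1 h2
  have := (sum_eq_zero_iff_of_nonneg (fun u _ => sq_nonneg (r u))).1 hR' u (mem_univ u)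
  have h0 : r u = 0 := pow_eq_zero_iff (two_ne_zero) |>.1 this
  simp only [hr] at h0
  linarith

lemma quad_le_quad_abs (G : SimpleGraph V) (x : V → ℝ) : quad G x ≤ quad G (fun v => |x v|) := by
  refine sum_le_sum fun u _ => ?_
  simp only [nbrSum, mul_sum]
  refine sum_le_sum fun v _ => ?_
  rw [← abs_mul]; exact le_abs_self _

/-- The spectral radius of the adjacency matrix as a real number. -/
noncomputable def rho (G : SimpleGraph V) : ℝ := (adjSpectralRadius G).toReal

open Classical in
lemma mulVec_adjMatrix_eq_nbrSum (G : SimpleGraph V) (x : V → ℝ) :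
    (G.adjMatrix ℝ).mulVec x = nbrSum G x := by
  ext u
  rw [SimpleGraph.adjMatrix_mulVec_apply, nbrSum]
  refine sum_congr ?_ fun _ _ => rfl
  ext v; simp

open Classical in
lemma adjSpectralRadius_eq_ofReal {G : SimpleGraph V} {ρ : ℝ} {x : V → ℝ}
    (hρ : ∀ y, quad G y ≤ ρ * ∑ u, y u ^ 2) (hx : ∀ u, nbrSum G x u = ρ * x u) (hx0 : x ≠ 0)
    (hρ0 : 0 ≤ ρ) : adjSpectralRadius G = ENNReal.ofReal ρ := by
  unfold adjSpectralRadius spectralRadius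
  apply le_antisymm
  · refine iSup₂_le fun k hk => ?_
    rw [← Matrix.spectrum_toLin', ← Module.End.hasEigenvalue_iff_mem_spectrum] at hk
    obtain ⟨y, hy⟩ := hk.exists_hasEigenvector
    have hy1 : ∀ u, nbrSum G y u = k * y u := by
      intro u
      have := congrFun hy.apply_eq_smul u
      rw [Matrix.toLin'_apply] at this
      rw [← mulVec_adjMatrix_eq_nbrSum]
      simpa using this
    have hpos : 0 < ∑ u, y u ^ 2 := by
      obtain ⟨u, hu⟩ := Function.ne_iff.1 hy.2
      exact sum_pos' (fun u _ => sq_nonneg _) ⟨u, mem_univ u, by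
        have : y u ≠ 0 := hu
        positivity⟩
    have h1 : |k| * ∑ u, y u ^ 2 ≤ quad G (fun v => |y v|) := by
      rw [quad, mul_sum]
      refine sum_le_sum fun u _ => ?_
      have h2 : |k| * |y u| ≤ nbrSum G (fun v => |y v|) u := by
        rw [← abs_mul, ← hy1]; exact abs_sum_le_sum_abs _ _
      calc |k| * y u ^ 2 = |y u| * (|k| * |y u|) := by rw [← sq_abs (y u)]; ring
        _ ≤ _ := mul_le_mul_of_nonneg_left h2 (abs_nonneg _)
    have h3 := h1.trans (hρ _)
    simp only [sq_abs] at h3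
    have h4 : |k| ≤ ρ := le_of_mul_le_mul_right h3 hpos
    exact ENNReal.coe_le_coe.2 ((Real.le_toNNReal_iff_coe_le hρ0).2 h4)
  · have hmem : ρ ∈ spectrum ℝ (G.adjMatrix ℝ) := by
      rw [← Matrix.spectrum_toLin', ← Module.End.hasEigenvalue_iff_mem_spectrum]
      refine Module.End.hasEigenvalue_of_hasEigenvector (x := x) ⟨?_, hx0⟩
      rw [Module.End.mem_eigenspace_iff, Matrix.toLin'_apply, mulVec_adjMatrix_eq_nbrSum]
      ext u; simp [hx]
    refine le_trans ?_ (le_iSup₂ (f := fun (k : ℝ) (_ : k ∈ spectrum ℝ (G.adjMatrix ℝ)) =>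
      (‖k‖₊ : ENNReal)) ρ hmem)
    exact ENNReal.coe_le_coe.2 (Real.toNNReal_le_iff_le_coe.2 (le_abs_self ρ))

/-- Perron's theorem for a graph: the spectral radius is the maximum of the Rayleigh quotient and
has a nonnegative eigenvector, normalised here to have maximum entry `1`. -/
theorem exists_perron [Nonempty V] (G : SimpleGraph V) :
    0 ≤ rho G ∧ adjSpectralRadius G = ENNReal.ofReal (rho G) ∧
    (∀ y, quad G y ≤ rho G * ∑ u, y u ^ 2) ∧
    ∃ x : V → ℝ, (∀ v, 0 ≤ x v) ∧ (∀ v, x v ≤ 1) ∧ (∃ z, x z = 1) ∧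
      ∀ u, rho G * x u = ∑ v ∈ nbr G u, x v := by
  classical
  set K : Set (V → ℝ) := {x | ∑ u, x u ^ 2 = 1} with hK
  have hcont : Continuous (quad G) := by
    unfold quad nbrSum; fun_prop
  have hKc : IsCompact K := by
    refine (isCompact_Icc (a := fun _ : V => (-1 : ℝ)) (b := fun _ => 1)).of_isClosed_subset
      (isClosed_eq (by fun_prop) continuous_const) ?_
    intro x hx
    have h : ∀ v, x v ^ 2 ≤ 1 := fun v => by
      rw [← show ∑ u, x u ^ 2 = 1 from hx]
      exact single_le_sum (fun u _ => sq_nonneg (x u)) (mem_univ v)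
    exact ⟨fun v => (abs_le_one_iff_mul_self_le_one.2 (by nlinarith [h v]) |> abs_le.1).1,
      fun v => (abs_le_one_iff_mul_self_le_one.2 (by nlinarith [h v]) |> abs_le.1).2⟩
  have hne : K.Nonempty := by
    obtain ⟨v⟩ := ‹Nonempty V›
    exact ⟨Pi.single v 1, by simp [hK, Pi.single_apply]⟩
  obtain ⟨x₀, hx₀, hmax⟩ := hKc.exists_isMaxOn hne hcont.continuousOn
  set ρ := quad G x₀ with hρdef
  have hray : ∀ y, quad G y ≤ ρ * ∑ u, y u ^ 2 := by
    intro y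
    rcases eq_or_ne (∑ u, y u ^ 2) 0 with h0 | h0
    · have : ∀ u, y u = 0 := fun u => pow_eq_zero_iff (two_ne_zero) |>.1
        ((sum_eq_zero_iff_of_nonneg (fun u _ => sq_nonneg (y u))).1 h0 u (mem_univ u))
      simp [quad, this]
    · have hpos : 0 < ∑ u, y u ^ 2 := lt_of_le_of_ne (sum_nonneg fun u _ => sq_nonneg _) h0.symm
      set s := Real.sqrt (∑ u, y u ^ 2) with hs
      have hs2 : s ^ 2 = ∑ u, y u ^ 2 := Real.sq_sqrt hpos.le
      have hs0 : 0 < s := Real.sqrt_pos.2 hpos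
      have hmem : (fun v => 0 + s⁻¹ * y v) ∈ K := by
        change ∑ u, (0 + s⁻¹ * y u) ^ 2 = 1
        simp only [zero_add, mul_pow, ← mul_sum, ← hs2]
        field_simp
      have h := hmax hmem
      have e : quad G (fun v => 0 + s⁻¹ * y v) = s⁻¹ ^ 2 * quad G y := by
        rw [quad_add_smul (x := fun _ => 0)]; simp [quad, nbrSum]
      replace h : quad G (fun v => 0 + s⁻¹ * y v) ≤ ρ := h
      rw [e] at h
      rw [← hs2]
      rw [inv_pow, inv_mul_le_iff₀ (by positivity)] at h
      linarith
  have hx₁ : ∑ u, |x₀ u| ^ 2 = 1 := by simp only [sq_abs]; exact hx₀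
  set x₁ : V → ℝ := fun v => |x₀ v| with hx₁def
  -- taking absolute values entrywise does not decrease the quadratic form
  have hq : quad G x₁ = ρ * ∑ u, x₁ u ^ 2 :=
    le_antisymm (hray _) (by rw [hx₁, mul_one]; exact quad_le_quad_abs G x₀)
  have heig := nbrSum_eq_of_quad_eq hray hq
  have hρ0 : 0 ≤ ρ := by
    have : ρ = quad G x₁ := by rw [hq, hx₁, mul_one]
    rw [this]
    exact sum_nonneg fun u _ => mul_nonneg (abs_nonneg _) (sum_nonneg fun v _ => abs_nonneg _)
  obtain ⟨z, hz⟩ := Finite.exists_max x₁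
  have hz0 : 0 < x₁ z := by
    by_contra h
    have h0 : ∀ v, x₁ v = 0 := fun v => le_antisymm ((hz v).trans (not_lt.1 h)) (abs_nonneg _)
    have h1 : ∑ u, x₁ u ^ 2 = 1 := hx₁
    simp only [h0] at h1
    simp at h1
  have hne0 : x₁ ≠ 0 := fun h => by rw [h] at hz0; simp at hz0
  have hsr := adjSpectralRadius_eq_ofReal hray heig hne0 hρ0
  have hrho : rho G = ρ := by rw [rho, hsr, ENNReal.toReal_ofReal hρ0]
  rw [hrho]
  refine ⟨hρ0, hsr, hray, fun v => x₁ v / x₁ z, fun v => div_nonneg (abs_nonneg _) hz0.le,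
    fun v => (div_le_one hz0).2 (hz v), ⟨z, div_self hz0.ne'⟩, fun u => ?_⟩
  rw [← sum_div, ← mul_div_assoc, ← heig u, nbrSum]

end Perron

/-! ### Packings of four-cycles through a vertex -/

section Combinatorics

open Classical in
/-- `Packs G u k X` says that `G` has `k` four-cycles `u, a, b, c` through `u` whose vertices other
than `u` are pairwise distinct and avoid `X`. -/
def Packs {V : Type*} (G : SimpleGraph V) (u : V) : ℕ → Finset V → Prop
  | 0, _ => True
  | k + 1, X => ∃ a b c, a ∉ X ∧ b ∉ X ∧ c ∉ X ∧ a ≠ c ∧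
      G.Adj u a ∧ G.Adj a b ∧ G.Adj b c ∧ G.Adj c u ∧ Packs G u k (X ∪ {a, b, c})

variable {V : Type*} {G : SimpleGraph V} {u : V}

open Classical in
lemma Packs.exists_map {k : ℕ} {X : Finset V} (h : Packs G u k X) :
    ∃ f : Fin k × Fin 3 → V, Function.Injective f ∧ (∀ p, f p ∉ X) ∧
      ∀ i, G.Adj u (f (i, 0)) ∧ G.Adj (f (i, 0)) (f (i, 1)) ∧ G.Adj (f (i, 1)) (f (i, 2)) ∧
        G.Adj (f (i, 2)) u := by
  induction k generalizing X with
  | zero => exact ⟨fun p => p.1.elim0, fun p => p.1.elim0, fun p => p.1.elim0, fun i => i.elim0⟩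
  | succ k ih =>
    obtain ⟨a, b, c, ha, hb, hc, hac, h1, h2, h3, h4, hp⟩ := h
    obtain ⟨f, hinj, hX, hf⟩ := ih hp
    have hX' : ∀ p, f p ∉ X ∧ f p ≠ a ∧ f p ≠ b ∧ f p ≠ c := fun p => by
      have := hX p
      simp only [mem_union, mem_insert, mem_singleton, not_or] at this
      exact this
    refine ⟨fun p => Fin.cases (![a, b, c] p.2) (fun i => f (i, p.2)) p.1, ?_, ?_, ?_⟩
    · rintro ⟨i, j⟩ ⟨i', j'⟩ hij
      induction i using Fin.cases with
      | zero =>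
        induction i' using Fin.cases with
        | zero =>
          have hab := h2.ne
          have hbc := h3.ne
          fin_cases j <;> fin_cases j' <;> simp_all
        | succ i' =>
          obtain ⟨-, na, nb, nc⟩ := hX' (i', j')
          exfalso
          fin_cases j
          exacts [na hij.symm, nb hij.symm, nc hij.symm]
      | succ i =>
        induction i' using Fin.cases with
        | zero =>
          obtain ⟨-, na, nb, nc⟩ := hX' (i, j)
          exfalso
          fin_cases j'
          exacts [na hij, nb hij, nc hij]
        | succ i' =>
          have : (i, j) = (i', j') := hinj (by simpa using hij)
          simp only [Prod.mk.injEq] at this ⊢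
          exact ⟨by rw [this.1], this.2⟩
    · rintro ⟨i, j⟩
      induction i using Fin.cases with
      | zero => fin_cases j <;> simp_all
      | succ i => simpa using (hX' (i, j)).1
    · intro i
      induction i using Fin.cases with
      | zero => simpa using ⟨h1, h2, h3, h4⟩
      | succ i => simpa using hf i

lemma isContained_of_packs {t : ℕ} (h : Packs G u t {u}) :
    (intersectingFourCycles t).IsContained G := by
  obtain ⟨f, hinj, hX, hf⟩ := h.exists_map
  have hadj : ∀ p q : Option (Fin t × Fin 3), (match p, q with
      | none, none => False
      | none, some (_, j) => (j : ℕ) = 0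
      | some (i, j), some (i', j') => i = i' ∧ (j' : ℕ) = (j : ℕ) + 1
      | some (_, j), none => (j : ℕ) = 2) → G.Adj (p.elim u f) (q.elim u f) := by
    rintro (_ | ⟨i, j⟩) (_ | ⟨i', j'⟩) h
    · exact h.elim
    · have : j' = 0 := Fin.ext h
      subst this; exact (hf i').1
    · have : j = 2 := Fin.ext h
      subst this; exact (hf i).2.2.2
    · obtain ⟨rfl, h⟩ := h
      fin_cases j <;> fin_cases j' <;> simp at h
      · exact (hf i).2.1
      · exact (hf i).2.2.1
  refine ⟨⟨⟨fun p => p.elim u f, ?_⟩, ?_⟩⟩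
  · intro p q h
    rcases h with ⟨_, h | h⟩
    · exact hadj p q h
    · exact (hadj q p h).symm
  · rintro (_ | p) (_ | q) h
    · rfl
    · exact absurd (mem_singleton.2 h.symm) (hX q)
    · exact absurd (mem_singleton.2 h) (hX p)
    · exact congrArg some (hinj h)

open Classical in
/-- If there is no packing of `k` four-cycles through `u`, then a bounded set meets all four-cycles
through `u`: the vertices of a maximal packing. -/
lemma exists_hitting_set {k : ℕ} {X : Finset V} (h : ¬ Packs G u k X) :
    ∃ S : Finset V, X ⊆ S ∧ S.card ≤ X.card + 3 * k ∧
      ∀ a b c, a ∉ S → b ∉ S → c ∉ S → a ≠ c → G.Adj u a → G.Adj a b → G.Adj b c →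
        ¬ G.Adj c u := by
  induction k generalizing X with
  | zero => exact absurd trivial h
  | succ k ih =>
    by_cases hc : ∃ a b c, a ∉ X ∧ b ∉ X ∧ c ∉ X ∧ a ≠ c ∧
      G.Adj u a ∧ G.Adj a b ∧ G.Adj b c ∧ G.Adj c u
    · obtain ⟨a, b, c, ha, hb, hcX, hac, h1, h2, h3, h4⟩ := hc
      have : ¬ Packs G u k (X ∪ {a, b, c}) := fun hp =>
        h ⟨a, b, c, ha, hb, hcX, hac, h1, h2, h3, h4, hp⟩
      obtain ⟨S, hXS, hcard, hS⟩ := ih this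
      have := card_union_le X {a, b, c}
      have := card_le_three (a := a) (b := b) (c := c)
      exact ⟨S, subset_union_left.trans hXS, by omega, hS⟩
    · refine ⟨X, Subset.rfl, by omega, fun a b c ha hb hcX hac h1 h2 h3 h4 => hc ?_⟩
      exact ⟨a, b, c, ha, hb, hcX, hac, h1, h2, h3, h4⟩

variable [Fintype V]

open Classical in
/-- If every vertex of `Q` has many common neighbours with `u`, then four-cycles through `u` with
the vertices of `Q` opposite to `u` can be chosen greedily. -/
lemma packs_of_middles {Q X : Finset V} (hu : u ∈ X) (hQX : Disjoint Q X)
    (hQ : ∀ m ∈ Q, X.card + 3 * Q.card ≤ (nbr G u ∩ nbr G m).card) : Packs G u Q.card X := by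
  induction Q using Finset.induction_on generalizing X with
  | empty => trivial
  | insert m Q hm ih =>
    rw [card_insert_of_notMem hm] at hQ ⊢
    have hmX : m ∉ X := fun h => disjoint_left.1 hQX (mem_insert_self m Q) h
    have hlt : 1 < ((nbr G u ∩ nbr G m) \ (X ∪ Q)).card := by
      have h1 := hQ m (mem_insert_self m Q)
      have h2 := le_card_sdiff (X ∪ Q) (nbr G u ∩ nbr G m)
      have h3 := card_union_le X Q
      omega
    obtain ⟨a, ha, c, hc, hac⟩ := one_lt_card.1 hlt
    simp only [mem_sdiff, mem_inter, mem_nbr, mem_union, not_or] at ha hc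
    refine ⟨a, m, c, ha.2.1, hmX, hc.2.1, hac, ha.1.1, ha.1.2.symm, hc.1.2, hc.1.1.symm, ?_⟩
    apply ih (mem_union_left _ hu)
    · rw [disjoint_left]
      intro q hq hqX
      rcases mem_union.1 hqX with h | h
      · exact disjoint_left.1 hQX (mem_insert_of_mem hq) h
      · simp only [mem_insert, mem_singleton] at h
        rcases h with rfl | rfl | rfl
        · exact ha.2.2 hq
        · exact hm hq
        · exact hc.2.2 hq
    · intro q hq
      have h1 := hQ q (mem_insert_of_mem hq)
      have h2 := card_union_le X {a, m, c}
      have h3 := card_le_three (a := a) (b := m) (c := c)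
      omega

end Combinatorics

/-! ### Counting in graphs without intersecting four-cycles -/

section Counting

variable {V : Type*} [Fintype V] {G : SimpleGraph V} {t : ℕ}

open Classical in
lemma sum_nbr_inter_comm (A : Finset V) (f : V → ℝ) :
    ∑ w ∈ A, ∑ y ∈ nbr G w, f y = ∑ y, ((nbr G y ∩ A).card : ℝ) * f y := by
  have : ∀ w, ∑ y ∈ nbr G w, f y = ∑ y, if G.Adj w y then f y else 0 := fun w => by
    rw [nbr, sum_filter]
  simp only [this]
  rw [sum_comm]
  refine sum_congr rfl fun y _ => ?_
  rw [← sum_filter, sum_const, nsmul_eq_mul]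
  congr 3
  ext w
  simp [and_comm, G.adj_comm]

open Classical in
/-- In a graph without `t` intersecting four-cycles, outside a set `S` of bounded size every vertex
ends at most one walk of length two from `u`. Hence walks of length two from `u` through `W`,
weighted by their endpoint, carry little weight beyond those that meet `S`. -/
lemma exists_two_walk_bound (hG : ¬ (intersectingFourCycles t).IsContained G) (u : V) :
    ∃ S : Finset V, S.card ≤ 3 * t + 1 ∧ ∀ (W : Finset V) (f : V → ℝ), (∀ v, 0 ≤ f v) →
      ∑ w ∈ nbr G u ∩ W, ∑ y ∈ nbr G w, f y ≤
        ∑ w ∈ S ∩ W, ∑ y ∈ nbr G w, f y + ∑ y ∈ S, ((nbr G y ∩ W).card : ℝ) * f y + ∑ y, f y := by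
  obtain ⟨S, huS, hcard, hS⟩ := exists_hitting_set (fun h => hG (isContained_of_packs h) :
    ¬ Packs G u t {u})
  refine ⟨S, by rw [card_singleton] at hcard; omega, fun W f hf => ?_⟩
  have hnn : ∀ w, 0 ≤ ∑ y ∈ nbr G w, f y := fun w => sum_nonneg fun y _ => hf y
  have h1 : ∑ w ∈ nbr G u ∩ W, ∑ y ∈ nbr G w, f y ≤ ∑ w ∈ S ∩ W, ∑ y ∈ nbr G w, f y
      + ∑ w ∈ (nbr G u ∩ W) \ S, ∑ y ∈ nbr G w, f y := by
    rw [← sum_inter_add_sum_sdiff (nbr G u ∩ W) S]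
    gcongr ?_ + _
    refine sum_le_sum_of_subset_of_nonneg ?_ fun w _ _ => hnn w
    intro w; simp only [mem_inter]; tauto
  have h2 : ∑ w ∈ (nbr G u ∩ W) \ S, ∑ y ∈ nbr G w, f y
      ≤ ∑ y ∈ S, ((nbr G y ∩ W).card : ℝ) * f y + ∑ y, f y := by
    rw [sum_nbr_inter_comm]
    have h3 : ∀ y, ((nbr G y ∩ ((nbr G u ∩ W) \ S)).card : ℝ) * f y ≤
        (if y ∈ S then ((nbr G y ∩ W).card : ℝ) * f y else 0) + f y := by
      intro y
      by_cases hy : y ∈ S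
      · rw [if_pos hy]
        have : ((nbr G y ∩ ((nbr G u ∩ W) \ S)).card : ℝ) ≤ ((nbr G y ∩ W).card : ℝ) := by
          norm_cast
          refine card_le_card ?_
          intro w; simp only [mem_inter, mem_sdiff]; tauto
        have := mul_le_mul_of_nonneg_right this (hf y)
        linarith [hf y]
      · rw [if_neg hy, zero_add]
        have : ((nbr G y ∩ ((nbr G u ∩ W) \ S)).card : ℝ) ≤ 1 := by
          norm_cast
          rw [card_le_one]
          intro a ha c hc
          by_contra hac
          simp only [mem_inter, mem_sdiff, mem_nbr] at ha hc
          exact hS a y c ha.2.2 hy hc.2.2 hac ha.2.1.1 ha.1.symm hc.1 hc.2.1.1.symm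
        nlinarith [hf y]
    refine (sum_le_sum fun y _ => h3 y).trans ?_
    rw [sum_add_distrib, ← sum_filter]
    simp
  linarith

open Classical in
/-- In a graph without `t` intersecting four-cycles the number of walks of length two from a given
vertex inside a set `U` is linear in the size of `U`. -/
lemma two_walks_le (hG : ¬ (intersectingFourCycles t).IsContained G) (v : V) (U : Finset V) :
    ∑ w ∈ nbr G v ∩ U, ((nbr G w ∩ U).card : ℝ) ≤ (6 * t + 3) * U.card := by
  obtain ⟨S, hS, hb⟩ := exists_two_walk_bound hG v
  have h := hb U (fun y => if y ∈ U then 1 else 0) (fun y => by split_ifs <;> norm_num)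
  have e : ∀ w, ∑ y ∈ nbr G w, (if y ∈ U then (1 : ℝ) else 0) = ((nbr G w ∩ U).card : ℝ) := by
    intro w
    rw [← sum_filter, sum_const, nsmul_eq_mul, mul_one, filter_mem_eq_inter]
  have hle : ∀ w, ((nbr G w ∩ U).card : ℝ) ≤ U.card := fun w => by
    exact_mod_cast card_le_card inter_subset_right
  have hSr : (S.card : ℝ) ≤ 3 * t + 1 := by exact_mod_cast hS
  simp only [e] at h
  have h1 : ∑ w ∈ S ∩ U, ((nbr G w ∩ U).card : ℝ) ≤ S.card * U.card := by
    refine (sum_le_sum_of_subset_of_nonneg inter_subset_left fun _ _ _ => by positivity).trans ?_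
    rw [← nsmul_eq_mul]
    exact sum_le_card_nsmul _ _ _ fun w _ => hle w
  have h2 : ∑ y ∈ S, ((nbr G y ∩ U).card : ℝ) * (if y ∈ U then (1 : ℝ) else 0)
      ≤ S.card * U.card := by
    rw [← nsmul_eq_mul]
    refine sum_le_card_nsmul _ _ _ fun w _ => ?_
    have := hle w
    split_ifs <;> simp [this]
  have h3 : ∑ y : V, (if y ∈ U then (1 : ℝ) else 0) = U.card := by simp
  have h4 : (S.card : ℝ) * U.card ≤ (3 * t + 1) * U.card := by gcongr
  linarith

open Classical in
/-- The graph contains no large complete bipartite graph with a part of size `t + 1`. -/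
lemma card_common_nbrs_le (hG : ¬ (intersectingFourCycles t).IsContained G) {T : Finset V}
    (hT : T.card = t + 1) : (univ.filter fun w => T ⊆ nbr G w).card ≤ 3 * t + 1 := by
  by_contra hlt
  push Not at hlt
  obtain ⟨u, hu⟩ : T.Nonempty := card_pos.1 (by omega)
  have hQ : (T.erase u).card = t := by rw [card_erase_of_mem hu, hT]; rfl
  apply hG
  have := packs_of_middles (G := G) (u := u) (Q := T.erase u) (X := {u}) (mem_singleton_self u)
    (by simp) ?_
  · rw [hQ] at this; exact isContained_of_packs this
  · intro m hm
    rw [hQ, card_singleton]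
    refine le_trans (by omega) (card_le_card (s := univ.filter fun w => T ⊆ nbr G w) ?_)
    intro w hw
    simp only [mem_filter, mem_univ, true_and] at hw
    rw [mem_inter]
    have h1 := hw hu
    have h2 := hw (mem_of_mem_erase hm)
    rw [mem_nbr] at h1 h2
    exact ⟨mem_nbr.2 h1.symm, mem_nbr.2 h2.symm⟩

open Classical in
lemma card_many_nbrs_le (hG : ¬ (intersectingFourCycles t).IsContained G) (D : Finset V) :
    (univ.filter fun w => t < (nbr G w ∩ D).card).card ≤ 2 ^ D.card * (3 * t + 1) := by
  have hsub : (univ.filter fun w => t < (nbr G w ∩ D).card) ⊆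
      (D.powersetCard (t + 1)).biUnion fun T => univ.filter fun w => T ⊆ nbr G w := by
    intro w hw
    simp only [mem_filter, mem_univ, true_and] at hw
    obtain ⟨T, hT, hTc⟩ := exists_subset_card_eq (Nat.succ_le_of_lt hw)
    simp only [mem_biUnion, mem_powersetCard, mem_filter, mem_univ, true_and]
    exact ⟨T, ⟨hT.trans inter_subset_right, hTc⟩, hT.trans inter_subset_left⟩
  refine (card_le_card hsub).trans ((card_biUnion_le_card_mul _ _ (3 * t + 1) ?_).trans ?_)
  · intro T hT
    exact card_common_nbrs_le hG (mem_powersetCard.1 hT).2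
  · gcongr
    rw [← card_powerset]
    exact card_le_card fun T hT => mem_powerset.2 (mem_powersetCard.1 hT).1

open Classical in
/-- A vertex `w` has at most `t` neighbours in a bounded set `D`, up to a bounded number of
exceptional `w`; this bounds sums over neighbours in `D`. -/
lemma sum_card_inter_le (hG : ¬ (intersectingFourCycles t).IsContained G) (D A : Finset V) :
    ∑ w ∈ A, ((nbr G w ∩ D).card : ℝ) ≤
      t * A.card + D.card * (2 ^ D.card * (3 * t + 1)) := by
  have h : ∀ w ∈ A, ((nbr G w ∩ D).card : ℝ) ≤
      t + if t < (nbr G w ∩ D).card then (D.card : ℝ) else 0 := by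
    intro w _
    split_ifs with hw
    · have : ((nbr G w ∩ D).card : ℝ) ≤ D.card := by
        exact_mod_cast card_le_card inter_subset_right
      have : (0 : ℝ) ≤ t := by positivity
      linarith
    · rw [add_zero]; exact_mod_cast not_lt.1 hw
  refine (sum_le_sum h).trans ?_
  rw [sum_add_distrib, sum_const, nsmul_eq_mul, ← sum_filter, sum_const, nsmul_eq_mul,
    mul_comm (A.card : ℝ), mul_comm _ (D.card : ℝ)]
  gcongr
  have h1 := card_many_nbrs_le hG D
  have h2 : (A.filter fun w => t < (nbr G w ∩ D).card).card ≤ 2 ^ D.card * (3 * t + 1) :=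
    (card_le_card (filter_subset_filter _ (subset_univ A))).trans h1
  exact_mod_cast h2

/-- Only boundedly many vertices have linear degree. -/
lemma card_large_degree_lt (hG : ¬ (intersectingFourCycles t).IsContained G) {δ : ℝ} {K : ℕ}
    (hK : (t : ℝ) + 1 ≤ K * δ) (hn : (K : ℝ) * (2 ^ K * (3 * t + 1)) < Fintype.card V) :
    (univ.filter fun v => δ * Fintype.card V ≤ ((nbr G v).card : ℝ)).card < K := by
  classical
  by_contra hlt
  push Not at hlt
  obtain ⟨D, hD, hDc⟩ := exists_subset_card_eq hlt
  have h1 := sum_card_inter_le hG D univ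
  rw [hDc, card_univ] at h1
  have h2 : ∑ w : V, ((nbr G w ∩ D).card : ℝ) = ∑ v ∈ D, ((nbr G v).card : ℝ) := by
    have := sum_nbr_inter_comm (G := G) D (fun _ => 1)
    simp only [mul_one, sum_const, nsmul_eq_mul] at this
    exact this.symm
  have h3 : (K : ℝ) * (δ * Fintype.card V) ≤ ∑ v ∈ D, ((nbr G v).card : ℝ) := by
    rw [← hDc, ← nsmul_eq_mul]
    exact card_nsmul_le_sum _ _ _ fun v hv => (mem_filter.1 (hD hv)).2
  have h4 : ((t : ℝ) + 1) * Fintype.card V ≤ K * δ * Fintype.card V := by gcongr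
  linarith

end Counting

/-! ### The extremal graph contains no intersecting four-cycles -/

section NotContained

/-- Every four-cycle uses one of the `t` dominating vertices outside the common vertex of the
cycles. These vertices are then used up, so a cycle would run through two vertices at distance two
in the matching. -/
lemma not_isContained_extremalGraph {n t : ℕ} (ht : 1 ≤ t) :
    ¬ (intersectingFourCycles t).IsContained (extremalGraph n t) := by
  rintro ⟨f⟩
  have hinj : Function.Injective f := f.injective'
  have hadj : ∀ {p q}, (intersectingFourCycles t).Adj p q → (extremalGraph n t).Adj (f p) (f q) :=
    fun h => f.toHom.map_adj h
  have hM : ∀ {a b c : Fin (n - t)}, (extremalGraph n t).Adj (Sum.inr a) (Sum.inr b) →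
      (extremalGraph n t).Adj (Sum.inr b) (Sum.inr c) → a = c := by
    intro a b c h1 h2
    have h1' : (maxMatching (n - t)).Adj a b := by
      simpa [extremalGraph, join] using h1
    have h2' : (maxMatching (n - t)).Adj b c := by
      simpa [extremalGraph, join] using h2
    have e1 := h1'.2
    have e2 := h2'.2
    have n1 := Fin.val_ne_of_ne h1'.1
    have n2 := Fin.val_ne_of_ne h2'.1
    apply Fin.ext
    omega
  have hP : ∀ {p q r}, (intersectingFourCycles t).Adj p q → (intersectingFourCycles t).Adj q r →
      p ≠ r → (∃ a, f p = Sum.inl a) ∨ (∃ a, f q = Sum.inl a) ∨ (∃ a, f r = Sum.inl a) := by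
    intro p q r h1 h2 hpr
    have h1 := hadj h1
    have h2 := hadj h2
    rcases hp : f p with a | a
    · exact Or.inl ⟨a, rfl⟩
    rcases hq : f q with b | b
    · exact Or.inr (Or.inl ⟨b, rfl⟩)
    rcases hr : f r with c | c
    · exact Or.inr (Or.inr ⟨c, rfl⟩)
    rw [hp, hq] at h1
    rw [hq, hr] at h2
    exact absurd (hinj (by rw [hp, hr, hM h1 h2])) hpr
  have a01 : ∀ i : Fin t, (intersectingFourCycles t).Adj (some (i, 0)) (some (i, 1)) := fun i => by
    simp [intersectingFourCycles]
  have a12 : ∀ i : Fin t, (intersectingFourCycles t).Adj (some (i, 1)) (some (i, 2)) := fun i => by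
    simp [intersectingFourCycles]
  have a0 : ∀ i : Fin t, (intersectingFourCycles t).Adj none (some (i, 0)) := fun i => by
    simp [intersectingFourCycles]
  have a2 : ∀ i : Fin t, (intersectingFourCycles t).Adj (some (i, 2)) none := fun i => by
    simp [intersectingFourCycles]
  have hg : ∀ i : Fin t, ∃ j : Fin 3, ∃ a, f (some (i, j)) = Sum.inl a := fun i => by
    rcases hP (a01 i) (a12 i) (by simp) with h | h | h
    exacts [⟨0, h⟩, ⟨1, h⟩, ⟨2, h⟩]
  choose g g' hg using hg
  have hgi : Function.Injective g' := fun i i' h => by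
    have := hinj ((hg i).trans ((congrArg Sum.inl h).trans (hg i').symm))
    simpa using (congrArg (Option.map Prod.fst) this)
  have hgs := Finite.surjective_of_injective hgi
  have huniq : ∀ p, (∃ a, f p = Sum.inl a) → ∃ i, p = some (i, g i) := by
    rintro p ⟨a, ha⟩
    obtain ⟨i, rfl⟩ := hgs a
    exact ⟨i, hinj (ha.trans (hg i).symm)⟩
  have hnone : ¬ ∃ a, f none = Sum.inl a := fun h => by
    obtain ⟨i, hi⟩ := huniq _ h
    simp at hi
  set i : Fin t := ⟨0, ht⟩
  have hi : ∀ j, (∃ a, f (some (i, j)) = Sum.inl a) → j = g i := fun j h => by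
    obtain ⟨i', hi'⟩ := huniq _ h
    simp only [Option.some.injEq, Prod.mk.injEq] at hi'
    obtain ⟨rfl, h⟩ := hi'
    exact h
  -- whichever vertex of the cycle is dominating, the three others form a path
  have h1 := hP (a0 i) (a01 i) (by simp)
  have h2 := hP (a2 i).symm (a12 i).symm (by simp)
  have h3 := hP (a0 i).symm (a2 i).symm (by simp)
  have k1 : g i = 0 ∨ g i = 1 := by
    rcases h1 with h | h | h
    exacts [(hnone h).elim, Or.inl (hi _ h).symm, Or.inr (hi _ h).symm]
  have k2 : g i = 2 ∨ g i = 1 := by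
    rcases h2 with h | h | h
    exacts [(hnone h).elim, Or.inl (hi _ h).symm, Or.inr (hi _ h).symm]
  have k3 : g i = 0 ∨ g i = 2 := by
    rcases h3 with h | h | h
    exacts [Or.inl (hi _ h).symm, (hnone h).elim, Or.inr (hi _ h).symm]
  generalize g i = j at k1 k2 k3
  revert k1 k2 k3
  fin_cases j <;> simp

end NotContained

/-! ### The spectral radius of the extremal graph -/

section Extremal

variable {V : Type*} [Fintype V] {G : SimpleGraph V}

lemma quad_comp_iso {W : Type*} [Fintype W] {H : SimpleGraph W} (e : G ≃g H) (y : V → ℝ) :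
    quad H (y ∘ e.symm) = quad G y := by
  classical
  unfold quad
  rw [← Equiv.sum_comp e.toEquiv]
  refine sum_congr rfl fun u _ => ?_
  have h1 : (y ∘ e.symm) (e.toEquiv u) = y u := by simp
  rw [h1, nbrSum_eq_sum_ite, nbrSum_eq_sum_ite, ← Equiv.sum_comp e.toEquiv]
  congr 1
  refine sum_congr rfl fun v _ => ?_
  have h2 : (y ∘ e.symm) (e.toEquiv v) = y v := by simp
  have h3 : H.Adj (e.toEquiv u) (e.toEquiv v) ↔ G.Adj u v := e.map_adj_iff
  simp only [h2, h3]

lemma quad_le_of_iso [Nonempty V] {W : Type*} [Fintype W] {H : SimpleGraph W} (e : G ≃g H)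
    (y : V → ℝ) : quad G y ≤ rho H * ∑ u, y u ^ 2 := by
  have : Nonempty W := ⟨e (Classical.arbitrary V)⟩
  have h := (exists_perron H).2.2.1 (y ∘ e.symm)
  rw [quad_comp_iso, ← Equiv.sum_comp e.toEquiv] at h
  simpa using h

lemma extremalGraph_adj_inl_inr {n t : ℕ} (i : Fin t) (j : Fin (n - t)) :
    (extremalGraph n t).Adj (Sum.inl i) (Sum.inr j) := by
  simp [extremalGraph, join]

lemma extremalGraph_adj_inl_inl {n t : ℕ} (i j : Fin t) :
    (extremalGraph n t).Adj (Sum.inl i) (Sum.inl j) ↔ i ≠ j := by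
  simp [extremalGraph, join]

lemma extremalGraph_adj_inr_inr {n t : ℕ} (i j : Fin (n - t)) :
    (extremalGraph n t).Adj (Sum.inr i) (Sum.inr j) ↔ i ≠ j ∧ (i : ℕ) / 2 = (j : ℕ) / 2 := by
  simp [extremalGraph, join, maxMatching]

/-- The bound comes from the complete bipartite subgraph `K_{t, n - t}`, with the test vector
equal to `ρ` on the first part and to `t` on the second. -/
lemma le_rho_extremalGraph_sq {n t : ℕ} (ht : 1 ≤ t) (hn : t ≤ n) :
    (t : ℝ) * (n - t) ≤ rho (extremalGraph n t) ^ 2 := by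
  have : Nonempty (Fin t ⊕ Fin (n - t)) := ⟨Sum.inl ⟨0, ht⟩⟩
  obtain ⟨h0, -, hray, -⟩ := exists_perron (extremalGraph n t)
  set ρ := rho (extremalGraph n t) with hρ
  have hcast : ((n - t : ℕ) : ℝ) = n - t := Nat.cast_sub hn
  have htr : (1 : ℝ) ≤ t := by exact_mod_cast ht
  have htn : (t : ℝ) ≤ n := by exact_mod_cast hn
  have key : ∀ a b : ℝ, 0 ≤ a → 0 ≤ b →
      2 * (t * (n - t)) * (a * b) ≤ ρ * (t * a ^ 2 + (n - t) * b ^ 2) := by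
    intro a b ha hb
    have h := hray (Sum.elim (fun _ => a) (fun _ => b))
    have hnn : ∀ u, 0 ≤ (Sum.elim (fun _ => a) (fun _ => b) : Fin t ⊕ Fin (n - t) → ℝ) u := by
      rintro (u | u) <;> simpa
    have hl : ∀ i : Fin t, ((n : ℝ) - t) * b ≤
        nbrSum (extremalGraph n t) (Sum.elim (fun _ => a) (fun _ => b)) (Sum.inl i) := by
      intro i
      have : ∑ v ∈ (univ : Finset (Fin (n - t))).map Function.Embedding.inr,
          (Sum.elim (fun _ => a) (fun _ => b) : Fin t ⊕ Fin (n - t) → ℝ) v = (n - t) * b := by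
        simp [hcast]
      rw [← this]
      refine sum_le_sum_of_subset_of_nonneg ?_ fun v _ _ => hnn v
      intro v hv
      obtain ⟨j, -, rfl⟩ := mem_map.1 hv
      exact mem_nbr.2 (extremalGraph_adj_inl_inr i j)
    have hr : ∀ i : Fin (n - t), (t : ℝ) * a ≤
        nbrSum (extremalGraph n t) (Sum.elim (fun _ => a) (fun _ => b)) (Sum.inr i) := by
      intro i
      have : ∑ v ∈ (univ : Finset (Fin t)).map Function.Embedding.inl,
          (Sum.elim (fun _ => a) (fun _ => b) : Fin t ⊕ Fin (n - t) → ℝ) v = t * a := by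
        simp
      rw [← this]
      refine sum_le_sum_of_subset_of_nonneg ?_ fun v _ _ => hnn v
      intro v hv
      obtain ⟨j, -, rfl⟩ := mem_map.1 hv
      exact mem_nbr.2 (extremalGraph_adj_inl_inr j i).symm
    have h1 : (t : ℝ) * (a * ((n - t) * b)) + (n - t) * (b * (t * a)) ≤
        quad (extremalGraph n t) (Sum.elim (fun _ => a) (fun _ => b)) := by
      rw [quad, Fintype.sum_sum_type]
      refine add_le_add ?_ ?_
      · have := card_nsmul_le_sum (univ : Finset (Fin t)) (fun i => a * nbrSum (extremalGraph n t)
          (Sum.elim (fun _ => a) (fun _ => b)) (Sum.inl i)) (a * ((n - t) * b))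
          fun i _ => mul_le_mul_of_nonneg_left (hl i) ha
        simpa using this
      · have := card_nsmul_le_sum (univ : Finset (Fin (n - t)))
          (fun i => b * nbrSum (extremalGraph n t)
          (Sum.elim (fun _ => a) (fun _ => b)) (Sum.inr i)) (b * (t * a))
          fun i _ => mul_le_mul_of_nonneg_left (hr i) hb
        simpa [hcast] using this
    have h2 : ∑ u, (Sum.elim (fun _ => a) (fun _ => b) : Fin t ⊕ Fin (n - t) → ℝ) u ^ 2
        = t * a ^ 2 + (n - t) * b ^ 2 := by
      rw [Fintype.sum_sum_type]; simp [hcast]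
    rw [h2] at h
    linarith
  rcases h0.eq_or_lt with h | h
  · have := key 1 1 zero_le_one zero_le_one
    rw [← h] at this ⊢
    linarith
  · have h3 := key ρ t h0 (by linarith)
    have h4 : (ρ * t) * (t * (n - t)) ≤ (ρ * t) * ρ ^ 2 := by
      nlinarith
    exact le_of_mul_le_mul_left h4 (by positivity)

end Extremal

/-! ### Recognising the extremal graph -/

section Structure

open Classical in
/-- A graph of maximum degree one on `m` vertices embeds into the matching `{2i, 2i + 1}`. -/
lemma exists_matching_labelling {V : Type*} {M : SimpleGraph V} (S : Finset V)
    (hM : ∀ b ∈ S, ∀ a ∈ S, ∀ c ∈ S, M.Adj a b → M.Adj b c → a = c) :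
    ∃ f : V → ℕ, Set.InjOn f S ∧ (∀ v ∈ S, f v < S.card) ∧
      ∀ a ∈ S, ∀ b ∈ S, M.Adj a b → f a / 2 = f b / 2 := by
  induction hk : S.card using Nat.strong_induction_on generalizing S with
  | _ k ih =>
    subst hk
    by_cases hE : ∃ a ∈ S, ∃ b ∈ S, M.Adj a b
    · obtain ⟨a, ha, b, hb, hab⟩ := hE
      have hcard : ((S.erase a).erase b).card + 2 = S.card := by
        have hb' : b ∈ S.erase a := mem_erase.2 ⟨hab.ne', hb⟩
        have h1 := card_erase_add_one hb'
        have h2 := card_erase_add_one ha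
        omega
      have hsub : (S.erase a).erase b ⊆ S := (erase_subset _ _).trans (erase_subset _ _)
      obtain ⟨f, hinj, hlt, hf⟩ := ih _ (by omega) ((S.erase a).erase b)
        (fun b hb a ha c hc => hM b (hsub hb) a (hsub ha) c (hsub hc)) rfl
      have hmem : ∀ v ∈ S, v ≠ a → v ≠ b → v ∈ (S.erase a).erase b := fun v hv h1 h2 =>
        mem_erase.2 ⟨h2, mem_erase.2 ⟨h1, hv⟩⟩
      refine ⟨fun v => if v = a then 0 else if v = b then 1 else f v + 2, ?_, ?_, ?_⟩
      · intro v hv w hw hvw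
        simp only at hvw
        by_cases h1 : v = a
        · by_cases h2 : w = a
          · rw [h1, h2]
          · rw [if_pos h1, if_neg h2] at hvw
            split_ifs at hvw
        by_cases h2 : v = b
        · by_cases h3 : w = b
          · rw [h2, h3]
          · rw [if_neg h1, if_pos h2, if_neg h3] at hvw
            split_ifs at hvw
            omega
        rw [if_neg h1, if_neg h2] at hvw
        by_cases h3 : w = a
        · rw [if_pos h3] at hvw; omega
        by_cases h4 : w = b
        · rw [if_neg h3, if_pos h4] at hvw; omega
        rw [if_neg h3, if_neg h4] at hvw
        exact hinj (hmem v hv h1 h2) (hmem w hw h3 h4) (by omega)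
      · intro v hv
        simp only
        split_ifs with h1 h2
        · omega
        · omega
        · have := hlt v (hmem v hv h1 h2); omega
      · intro v hv w hw hvw
        have k1 : v = a → w = b := by
          rintro rfl; exact hM v hv w hw b hb hvw.symm hab
        have k2 : v = b → w = a := by
          rintro rfl; exact hM v hv w hw a ha hvw.symm hab.symm
        have k3 : w = a → v = b := by
          rintro rfl; exact hM w hw v hv b hb hvw hab
        have k4 : w = b → v = a := by
          rintro rfl; exact hM w hw v hv a ha hvw hab.symm
        have hne := hab.ne'
        by_cases h1 : v = a
        · have := k1 h1; subst h1; subst this; simp [hne]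
        by_cases h2 : v = b
        · have := k2 h2; subst h2; subst this; simp [hne]
        have h3 : w ≠ a := fun h => h2 (k3 h)
        have h4 : w ≠ b := fun h => h1 (k4 h)
        have := hf v (hmem v hv h1 h2) w (hmem w hw h3 h4) hvw
        simp only [h1, h2, h3, h4, if_false]
        omega
    · refine ⟨fun v => if h : v ∈ S then S.equivFin ⟨v, h⟩ else 0, ?_, ?_, ?_⟩
      · intro v hv w hw hvw
        have hv' : v ∈ S := hv
        have hw' : w ∈ S := hw
        simp only [hv', hw', dif_pos] at hvw
        have := S.equivFin.injective (Fin.ext hvw)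
        simpa using this
      · intro v hv; simp [hv]
      · intro a ha b hb hab
        exact absurd ⟨a, ha, b, hb, hab⟩ hE

variable {V : Type*} [Fintype V]

/-- The join of the complete graph on `L` with the matching that pairs the vertices outside `L`
whose labels `f` are `2i` and `2i + 1`. -/
def labelledExtremal {V : Type*} (L : Finset V) (f : V → ℕ) : SimpleGraph V where
  Adj u w := u ≠ w ∧ (u ∈ L ∨ w ∈ L ∨ f u / 2 = f w / 2)
  symm := ⟨fun _ _ h => ⟨h.1.symm, by
    rcases h.2 with h | h | h
    exacts [Or.inr (Or.inl h), Or.inl h, Or.inr (Or.inr h.symm)]⟩⟩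
  loopless := ⟨fun _ h => h.1 rfl⟩

open Classical in
lemma nonempty_iso_extremalGraph {L : Finset V} {f : V → ℕ} {n t : ℕ} (hn : Fintype.card V = n)
    (hL : L.card = t) (hf : Set.InjOn f (Lᶜ : Finset V)) (hlt : ∀ v ∈ Lᶜ, f v < n - t) :
    Nonempty (labelledExtremal L f ≃g extremalGraph n t) := by
  set φ : V → Fin t ⊕ Fin (n - t) := fun v =>
    if h : v ∈ L then Sum.inl (L.equivFinOfCardEq hL ⟨v, h⟩)
    else Sum.inr ⟨f v, hlt v (mem_compl.2 h)⟩ with hφ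
  have hpos : ∀ v (h : v ∈ L), φ v = Sum.inl (L.equivFinOfCardEq hL ⟨v, h⟩) := fun v h => by
    simp [hφ, h]
  have hneg : ∀ v (h : v ∉ L), φ v = Sum.inr ⟨f v, hlt v (mem_compl.2 h)⟩ := fun v h => by
    simp [hφ, h]
  have hinj : Function.Injective φ := by
    intro v w hvw
    by_cases hv : v ∈ L <;> by_cases hw : w ∈ L
    · rw [hpos v hv, hpos w hw] at hvw
      simpa using hvw
    · rw [hpos v hv, hneg w hw] at hvw; simp at hvw
    · rw [hneg v hv, hpos w hw] at hvw; simp at hvw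
    · rw [hneg v hv, hneg w hw] at hvw
      simp only [Sum.inr.injEq, Fin.mk.injEq] at hvw
      exact hf (by simpa using hv) (by simpa using hw) hvw
  have htn : t ≤ n := by rw [← hL, ← hn]; exact card_le_univ L
  have hbij : Function.Bijective φ := by
    rw [Fintype.bijective_iff_injective_and_card]
    refine ⟨hinj, ?_⟩
    simp only [Fintype.card_sum, Fintype.card_fin]
    omega
  refine ⟨⟨Equiv.ofBijective φ hbij, ?_⟩⟩
  intro v w
  simp only [Equiv.ofBijective_apply]
  change _ ↔ v ≠ w ∧ (v ∈ L ∨ w ∈ L ∨ f v / 2 = f w / 2)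
  by_cases hv : v ∈ L <;> by_cases hw : w ∈ L
  · rw [hpos v hv, hpos w hw, extremalGraph_adj_inl_inl]
    simp [hv]
  · rw [hpos v hv, hneg w hw]
    have : v ≠ w := fun h => hw (h ▸ hv)
    simp [hv, this, extremalGraph_adj_inl_inr]
  · rw [hneg v hv, hpos w hw]
    have : v ≠ w := fun h => hv (h ▸ hw)
    simp [hw, this, (extremalGraph_adj_inl_inr _ _).symm]
  · rw [hneg v hv, hneg w hw, extremalGraph_adj_inr_inr]
    simp only [hv, hw, false_or, ne_eq, Fin.mk.injEq]
    refine and_congr_left fun _ => not_congr ⟨fun h => ?_, fun h => h ▸ rfl⟩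
    exact hf (by simpa using hv) (by simpa using hw) h

end Structure

/-! ### Stability: from large vertices to the extremal graph -/

section Stability

variable {V : Type*} [Fintype V] {G : SimpleGraph V} {t : ℕ}

open Classical in
/-- When the `t` vertices of `L` have pairwise many common neighbours, a four-cycle through some
`l ∈ L` that avoids the rest of `L` completes to `t` intersecting four-cycles. -/
lemma not_fourCycle_of_large (hG : ¬ (intersectingFourCycles t).IsContained G) {L : Finset V}
    (hL : L.card = t) (hdeg : ∀ l ∈ L, 4 * ((nbr G l)ᶜ).card ≤ Fintype.card V)
    (hn : 6 * t + 8 ≤ Fintype.card V) {l a b c : V} (hl : l ∈ L) (ha : a ∉ L) (hb : b ∉ L)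
    (hc : c ∉ L) (hac : a ≠ c) (h1 : G.Adj l a) (h2 : G.Adj a b) (h3 : G.Adj b c) :
    ¬ G.Adj c l := by
  intro h4
  apply hG
  obtain ⟨s, rfl⟩ : ∃ s, t = s + 1 := ⟨t - 1, by have := card_pos.2 ⟨l, hl⟩; omega⟩
  have hQ : (L.erase l).card = s := by rw [card_erase_of_mem hl, hL]; rfl
  have hne : ∀ v, v ∉ L → v ∉ ({l} : Finset V) := fun v hv h => hv (by
    rw [mem_singleton.1 h]; exact hl)
  refine isContained_of_packs (u := l) ⟨a, b, c, hne a ha, hne b hb, hne c hc, hac, h1, h2, h3,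
    h4, ?_⟩
  have := packs_of_middles (G := G) (u := l) (Q := L.erase l) (X := {l} ∪ {a, b, c}) (by simp) ?_ ?_
  · rw [hQ] at this; exact this
  · rw [disjoint_left]
    intro v hv hv'
    simp only [mem_union, mem_insert, mem_singleton] at hv'
    rcases hv' with rfl | rfl | rfl | rfl
    · exact absurd rfl (ne_of_mem_erase hv)
    · exact ha (mem_of_mem_erase hv)
    · exact hb (mem_of_mem_erase hv)
    · exact hc (mem_of_mem_erase hv)
  · intro m hm
    have e1 := card_union_le {l} ({a, b, c} : Finset V)
    have e2 := card_le_three (a := a) (b := b) (c := c)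
    have e3 := card_singleton l
    have e4 := hdeg l hl
    have e5 := hdeg m (mem_of_mem_erase hm)
    have e6 := card_union_le (nbr G l)ᶜ (nbr G m)ᶜ
    rw [← compl_inter, card_compl] at e6
    rw [hQ]
    omega

open Classical in
/-- A vertex `v` outside `L` has at most one neighbour outside `L` in the neighbourhood of a given
vertex of `L`, hence at most `t` neighbours outside `L` that have a neighbour in `L` at all. -/
lemma card_nbr_outside_le (hG : ¬ (intersectingFourCycles t).IsContained G) {L : Finset V}
    (hL : L.card = t) (hdeg : ∀ l ∈ L, 4 * ((nbr G l)ᶜ).card ≤ Fintype.card V)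
    (hn : 6 * t + 8 ≤ Fintype.card V) {v : V} (hv : v ∉ L) :
    ((nbr G v).filter fun w => w ∉ L ∧ ∃ l ∈ L, G.Adj w l).card ≤ t := by
  have hsub : ((nbr G v).filter fun w => w ∉ L ∧ ∃ l ∈ L, G.Adj w l) ⊆
      L.biUnion fun l => (nbr G v).filter fun w => w ∉ L ∧ G.Adj w l := by
    intro w hw
    simp only [mem_filter, mem_biUnion] at hw ⊢
    obtain ⟨h1, h2, l, h3, h4⟩ := hw
    exact ⟨l, h3, h1, h2, h4⟩
  refine (card_le_card hsub).trans ((card_biUnion_le_card_mul _ _ 1 ?_).trans (by omega))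
  intro l hl
  rw [card_le_one]
  intro a ha c hc
  simp only [mem_filter, mem_nbr] at ha hc
  by_contra hac
  exact not_fourCycle_of_large hG hL hdeg hn hl ha.2.1 hv hc.2.1 hac ha.2.2.symm ha.1.symm hc.1
    hc.2.2

open Classical in
/-- Outside `L` the neighbours of a vertex carry little weight of the Perron vector. -/
lemma sum_nbr_outside_le (hG : ¬ (intersectingFourCycles t).IsContained G) (ht : 1 ≤ t)
    {L : Finset V} (hL : L.card = t)
    (hdeg : ∀ l ∈ L, 64 * t * (7 * t + 3) * ((nbr G l)ᶜ).card ≤ Fintype.card V)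
    (hn : 2 * (32 * t ^ 2) ^ 2 ≤ Fintype.card V) {ρ : ℝ} (hρ0 : 0 ≤ ρ)
    (hρ : (t : ℝ) * (Fintype.card V - t) ≤ ρ ^ 2) {x : V → ℝ} (hx0 : ∀ v, 0 ≤ x v)
    (hx1 : ∀ v, x v ≤ 1) (hx : ∀ u, ρ * x u = ∑ v ∈ nbr G u, x v) {v : V} (hv : v ∉ L) :
    ∑ w ∈ nbr G v \ L, x w ≤ 1 / 4 := by
  set n := Fintype.card V with hndef
  have htr : (1 : ℝ) ≤ t := by exact_mod_cast ht
  have hnr : 2 * (32 * (t : ℝ) ^ 2) ^ 2 ≤ n := by exact_mod_cast hn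
  have hdeg4 : ∀ l ∈ L, 4 * ((nbr G l)ᶜ).card ≤ n := fun l hl => by
    refine le_trans ?_ (hdeg l hl)
    gcongr
    nlinarith
  have hn8 : 6 * t + 8 ≤ n := by
    refine le_trans ?_ hn
    nlinarith [Nat.pow_le_pow_left ht 2, Nat.pow_le_pow_left ht 4]
  have hn2 : 2 * (t : ℝ) ≤ n := by
    have : 2 * t ≤ n := by omega
    exact_mod_cast this
  have hnρ : (n : ℝ) ≤ 2 * ρ ^ 2 := by nlinarith
  have hρ32 : 32 * (t : ℝ) ^ 2 ≤ ρ := by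
    refine le_of_sq_le_sq ?_ hρ0
    linarith
  have hρpos : 0 < ρ := by nlinarith
  obtain ⟨p, hp, hpmax⟩ := exists_max_image (univ \ L) x ⟨v, by simpa using hv⟩
  have hpL : p ∉ L := (mem_sdiff.1 hp).2
  set M := x p with hM
  have hMle : ∀ w, w ∉ L → x w ≤ M := fun w hw => hpmax w (by simpa using hw)
  set B₀ : Finset V := univ.filter fun w => w ∉ L ∧ ∀ l ∈ L, ¬ G.Adj w l with hB₀
  have hB₀card : 64 * (t : ℝ) * (7 * t + 3) * B₀.card ≤ n := by
    obtain ⟨l, hl⟩ := card_pos.1 (by omega : 0 < L.card)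
    have h1 : B₀.card ≤ ((nbr G l)ᶜ).card := card_le_card fun w hw => by
      rw [mem_compl, mem_nbr]
      exact fun h => (mem_filter.1 hw).2.2 l hl h.symm
    have h2 := hdeg l hl
    have h3 : 64 * t * (7 * t + 3) * B₀.card ≤ n := le_trans (by gcongr) h2
    exact_mod_cast h3
  have hcardA : ∀ w, w ∉ L →
      (((nbr G w).filter fun y => y ∉ L ∧ ∃ l ∈ L, G.Adj y l).card : ℝ) ≤ t :=
    fun w hw => by exact_mod_cast card_nbr_outside_le hG hL hdeg4 hn8 hw
  have hsplit : ∀ w, nbr G w \ L ⊆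
      ((nbr G w).filter fun y => y ∉ L ∧ ∃ l ∈ L, G.Adj y l) ∪ (nbr G w ∩ B₀) := by
    intro w y hy
    simp only [mem_sdiff, mem_union, mem_filter, mem_inter, hB₀, mem_univ, true_and] at hy ⊢
    by_cases h : ∃ l ∈ L, G.Adj y l
    · exact Or.inl ⟨hy.1, hy.2, h⟩
    · push Not at h
      exact Or.inr ⟨hy.1, hy.2, h⟩
  -- vertices of `B₀` have all their neighbours outside `L`
  have hdB : ∀ w ∈ B₀, ((nbr G w).card : ℝ) ≤ t + ((nbr G w ∩ B₀).card : ℝ) := by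
    intro w hw
    have hw' := (mem_filter.1 hw).2
    have h1 : nbr G w ⊆ nbr G w \ L := fun y hy => mem_sdiff.2 ⟨hy, fun hyL =>
      hw'.2 y hyL (mem_nbr.1 hy)⟩
    have h2 := (card_le_card (h1.trans (hsplit w))).trans (card_union_le _ _)
    have h3 : ((nbr G w).card : ℝ) ≤
      (((nbr G w).filter fun y => y ∉ L ∧ ∃ l ∈ L, G.Adj y l).card : ℝ)
      + ((nbr G w ∩ B₀).card : ℝ) := by exact_mod_cast h2
    linarith [hcardA w hw'.1]
  have hM0 : 0 ≤ M := hx0 p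
  have hT : ∀ w, w ∉ L → ∑ y ∈ nbr G w \ L, x y ≤ ρ * M / (16 * t) := by
    intro w hw
    have h1 : ∑ y ∈ nbr G w \ L, x y ≤ t * M + ∑ y ∈ nbr G w ∩ B₀, x y := by
      refine (sum_le_sum_of_subset_of_nonneg (hsplit w) fun y _ _ => hx0 y).trans ?_
      have := sum_union_inter (s₁ := (nbr G w).filter fun y => y ∉ L ∧ ∃ l ∈ L, G.Adj y l)
        (s₂ := nbr G w ∩ B₀) (f := x)
      have hi : 0 ≤ ∑ y ∈ ((nbr G w).filter fun y => y ∉ L ∧ ∃ l ∈ L, G.Adj y l) ∩ (nbr G w ∩ B₀),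
        x y := sum_nonneg fun y _ => hx0 y
      have h2 : ∑ y ∈ (nbr G w).filter (fun y => y ∉ L ∧ ∃ l ∈ L, G.Adj y l), x y ≤ t * M := by
        refine (sum_le_card_nsmul _ _ M fun y hy => hMle y (mem_filter.1 hy).2.1).trans ?_
        rw [nsmul_eq_mul]
        exact mul_le_mul_of_nonneg_right (hcardA w hw) hM0
      linarith
    have h2 : ρ * ∑ y ∈ nbr G w ∩ B₀, x y ≤ M * ((7 * t + 3) * B₀.card) := by
      rw [mul_sum]
      calc ∑ y ∈ nbr G w ∩ B₀, ρ * x y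
          ≤ ∑ y ∈ nbr G w ∩ B₀, M * (t + ((nbr G y ∩ B₀).card : ℝ)) := by
            refine sum_le_sum fun y hy => ?_
            have hyB := (mem_inter.1 hy).2
            have hy' := (mem_filter.1 hyB).2
            rw [hx]
            refine (sum_le_card_nsmul _ _ M fun q hq => hMle q fun hqL =>
              hy'.2 q hqL (mem_nbr.1 hq)).trans ?_
            rw [nsmul_eq_mul, mul_comm]
            exact mul_le_mul_of_nonneg_left (hdB y hyB) hM0
        _ = M * (t * ((nbr G w ∩ B₀).card : ℝ)
            + ∑ y ∈ nbr G w ∩ B₀, ((nbr G y ∩ B₀).card : ℝ)) := by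
            rw [← mul_sum, sum_add_distrib, sum_const, nsmul_eq_mul, mul_comm (t : ℝ)]
        _ ≤ M * ((7 * t + 3) * B₀.card) := by
            refine mul_le_mul_of_nonneg_left ?_ hM0
            have h3 := two_walks_le hG w B₀
            have h4 : (t : ℝ) * ((nbr G w ∩ B₀).card : ℝ) ≤ t * B₀.card := by
              gcongr; exact inter_subset_right
            linarith
    have h3 : (7 * (t : ℝ) + 3) * B₀.card ≤ ρ ^ 2 / (32 * t) := by
      rw [le_div_iff₀ (by positivity)]
      linarith
    have h4 : ρ * ∑ y ∈ nbr G w ∩ B₀, x y ≤ ρ * (ρ * M / (32 * t)) := by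
      refine h2.trans ((mul_le_mul_of_nonneg_left h3 hM0).trans (le_of_eq ?_))
      ring
    have h5 := le_of_mul_le_mul_left h4 hρpos
    have h6 : (t : ℝ) * M ≤ ρ * M / (32 * t) := by
      rw [le_div_iff₀ (by positivity)]
      nlinarith
    have h7 : ρ * M / (16 * t) = ρ * M / (32 * t) + ρ * M / (32 * t) := by
      field_simp; ring
    linarith
  -- the eigenvalue equation at the vertex where `x` is maximal outside `L`
  have hp1 : ρ * M ≤ t + ρ * M / (16 * t) := by
    have hp0 : ρ * M = ∑ y ∈ nbr G p ∩ L, x y + ∑ y ∈ nbr G p \ L, x y := by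
      rw [sum_inter_add_sum_sdiff, ← hx]
    refine hp0.le.trans (add_le_add ?_ (hT p hpL))
    refine (sum_le_card_nsmul _ _ 1 fun y _ => hx1 y).trans ?_
    rw [nsmul_eq_mul, mul_one]
    rw [← hL]; exact_mod_cast card_le_card inter_subset_right
  have h8 : ρ * M / (16 * t) ≤ ρ * M / 16 := by
    gcongr
    linarith
  refine (hT v hv).trans ?_
  rw [div_le_iff₀ (by positivity)]
  linarith

open Classical in
/-- Exchange argument: if the sum of `x` over the outside neighbours is below the weight of each
vertex of `L`, then replacing the edges at the vertices that miss a neighbour in `L` by edges to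
`L` does not decrease the quadratic form; the gain is at least half the weight of those vertices. -/
lemma sum_le_quad_labelledExtremal_sub_quad {L : Finset V} {f : V → ℕ} {x : V → ℝ}
    (hx0 : ∀ v, 0 ≤ x v) (hxL : ∀ l ∈ L, 1 / 2 ≤ x l)
    (hf : ∀ a ∈ univ.filter (fun v => v ∉ L ∧ L ⊆ nbr G v),
      ∀ b ∈ univ.filter (fun v => v ∉ L ∧ L ⊆ nbr G v), G.Adj a b → f a / 2 = f b / 2)
    (hT : ∀ v ∉ L, ∑ w ∈ nbr G v \ L, x w ≤ 1 / 4) :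
    1 / 2 * ∑ v ∈ univ.filter (fun v => v ∉ L ∧ ¬ L ⊆ nbr G v), x v ≤
      quad (labelledExtremal L f) x - quad G x := by
  set B : Finset V := univ.filter (fun v => v ∉ L ∧ ¬ L ⊆ nbr G v) with hB
  set P : V → V → ℝ := fun u w => if u ∈ B then
    (if w ∈ L then (if G.Adj u w then 0 else 1) else (if G.Adj u w then -1 else 0)) else 0 with hP
  have hBL : ∀ u ∈ B, u ∉ L := fun u hu => (mem_filter.1 hu).2.1
  have hquad : ∀ H : SimpleGraph V, quad H x =
      ∑ u, ∑ w, (if H.Adj u w then 1 else 0) * (x u * x w) := by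
    intro H
    unfold quad
    refine sum_congr rfl fun u _ => ?_
    rw [nbrSum_eq_sum_ite, mul_sum]
    refine sum_congr rfl fun w _ => ?_
    split_ifs <;> simp
  -- `P` distributes the possible loss on an edge, and the gain on a missing edge to `L`, over the
  -- ends in `B`; all other pairs contribute nonnegatively
  have hpt : ∀ u w, P u w + P w u ≤ (if (labelledExtremal L f).Adj u w then (1 : ℝ) else 0)
      - (if G.Adj u w then 1 else 0) := by
    intro u w
    have hF : (labelledExtremal L f).Adj u w ↔ u ≠ w ∧ (u ∈ L ∨ w ∈ L ∨ f u / 2 = f w / 2) :=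
      Iff.rfl
    by_cases huw : u = w
    · subst huw
      have h1 : u ∈ B → u ∉ L := hBL u
      by_cases h : u ∈ B
      · simp [hP, h, h1 h]
      · simp [hP, h]
    have hsymm : G.Adj w u ↔ G.Adj u w := G.adj_comm w u
    by_cases hu : u ∈ L
    · have huB : u ∉ B := fun h => hBL u h hu
      have hadj : (labelledExtremal L f).Adj u w := hF.2 ⟨huw, Or.inl hu⟩
      simp only [hP, huB, if_false, hu, if_true, hadj, hsymm, zero_add]
      split_ifs <;> norm_num
    by_cases hw : w ∈ L
    · have hwB : w ∉ B := fun h => hBL w h hw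
      have hadj : (labelledExtremal L f).Adj u w := hF.2 ⟨huw, Or.inr (Or.inl hw)⟩
      simp only [hP, hwB, if_false, hw, if_true, hadj, add_zero]
      split_ifs <;> norm_num
    by_cases hG : G.Adj u w
    · by_cases huB : u ∈ B
      · simp only [hP, huB, if_true, hu, hw, if_false, hG, hsymm]
        split_ifs <;> norm_num
      by_cases hwB : w ∈ B
      · simp only [hP, huB, hwB, if_true, hu, if_false, hG, hsymm]
        split_ifs <;> norm_num
      have h1 : ∀ v, v ∉ L → v ∉ B → v ∈ univ.filter (fun v => v ∉ L ∧ L ⊆ nbr G v) := by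
        intro v hv hvB
        simp only [hB, mem_filter, mem_univ, true_and, not_and, not_not] at hvB ⊢
        exact ⟨hv, hvB hv⟩
      have hadj : (labelledExtremal L f).Adj u w :=
        hF.2 ⟨huw, Or.inr (Or.inr (hf u (h1 u hu huB) w (h1 w hw hwB) hG))⟩
      simp [hP, huB, hwB, hadj, hG]
    · simp only [hP, hu, hw, if_false, hG, hsymm]
      split_ifs <;> norm_num
  have hsumP : 1 / 4 * ∑ v ∈ B, x v ≤ ∑ u, ∑ w, P u w * (x u * x w) := by
    have e : ∀ u, ∑ w, P u w * (x u * x w) = if u ∈ B then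
        x u * (∑ w ∈ L \ nbr G u, x w - ∑ w ∈ nbr G u \ L, x w) else 0 := by
      intro u
      by_cases hu : u ∈ B
      · rw [if_pos hu]
        have e1 : ∑ w ∈ L \ nbr G u, x w = ∑ w, if w ∈ L ∧ ¬ G.Adj u w then x w else 0 := by
          rw [← sum_filter]
          refine sum_congr ?_ fun _ _ => rfl
          ext w; simp
        have e2 : ∑ w ∈ nbr G u \ L, x w = ∑ w, if w ∉ L ∧ G.Adj u w then x w else 0 := by
          rw [← sum_filter]
          refine sum_congr ?_ fun _ _ => rfl
          ext w; simp [and_comm]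
        rw [e1, e2, ← sum_sub_distrib, mul_sum]
        refine sum_congr rfl fun w _ => ?_
        by_cases hw : w ∈ L <;> by_cases ha : G.Adj u w <;> simp [hP, hu, hw, ha]
      · simp [hP, hu]
    simp only [e]
    rw [← sum_filter, filter_mem_eq_inter, univ_inter, mul_sum]
    refine sum_le_sum fun u hu => ?_
    rw [mul_comm]
    refine mul_le_mul_of_nonneg_left ?_ (hx0 u)
    have h1 := hT u (hBL u hu)
    have h2 : 1 / 2 ≤ ∑ w ∈ L \ nbr G u, x w := by
      obtain ⟨l, hl, hlu⟩ := not_subset.1 (mem_filter.1 hu).2.2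
      exact (hxL l hl).trans (single_le_sum (fun w _ => hx0 w) (mem_sdiff.2 ⟨hl, hlu⟩))
    linarith
  have hsumP' : ∑ u, ∑ w, P w u * (x u * x w) = ∑ u, ∑ w, P u w * (x u * x w) := by
    rw [sum_comm]
    exact sum_congr rfl fun u _ => sum_congr rfl fun w _ => by ring
  have h : ∑ u, ∑ w, (P u w + P w u) * (x u * x w) ≤ quad (labelledExtremal L f) x - quad G x := by
    rw [hquad, hquad, ← sum_sub_distrib]
    refine sum_le_sum fun u _ => ?_
    rw [← sum_sub_distrib]
    refine sum_le_sum fun w _ => ?_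
    rw [← sub_mul]
    exact mul_le_mul_of_nonneg_right (hpt u w) (mul_nonneg (hx0 u) (hx0 w))
  simp only [add_mul, sum_add_distrib, hsumP'] at h
  linarith

open Classical in
/-- A graph without `t` intersecting four-cycles and of spectral radius at least that of the
extremal graph is the extremal graph, provided that it has `t` vertices of large Perron weight
adjacent to almost all other vertices. -/
theorem nonempty_iso_of_large_vertices (hG : ¬ (intersectingFourCycles t).IsContained G)
    (ht : 1 ≤ t) {n : ℕ} (hcard : Fintype.card V = n) (hn : 2 * (32 * t ^ 2) ^ 2 ≤ n)
    (hrho : rho (extremalGraph n t) ≤ rho G)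
    {x : V → ℝ} (hx0 : ∀ v, 0 ≤ x v) (hx1 : ∀ v, x v ≤ 1)
    (hx : ∀ u, rho G * x u = ∑ v ∈ nbr G u, x v)
    {L : Finset V} (hL : L.card = t) (hxL : ∀ l ∈ L, 1 / 2 ≤ x l)
    (hdeg : ∀ l ∈ L, 64 * t * (7 * t + 3) * ((nbr G l)ᶜ).card ≤ n) :
    Nonempty (G ≃g extremalGraph n t) := by
  subst hcard
  set n := Fintype.card V with hndef
  obtain ⟨l₀, hl₀⟩ := card_pos.1 (by omega : 0 < L.card)
  have : Nonempty V := ⟨l₀⟩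
  have hn8 : 6 * t + 8 ≤ n := by
    refine le_trans ?_ hn
    nlinarith [Nat.pow_le_pow_left ht 2, Nat.pow_le_pow_left ht 4]
  have hdeg4 : ∀ l ∈ L, 4 * ((nbr G l)ᶜ).card ≤ n := fun l hl => by
    refine le_trans ?_ (hdeg l hl)
    gcongr
    nlinarith
  have hFsq := le_rho_extremalGraph_sq (n := n) ht (by omega)
  have : Nonempty (Fin t ⊕ Fin (n - t)) := ⟨Sum.inl ⟨0, ht⟩⟩
  have hF0 := (exists_perron (extremalGraph n t)).1
  have htr : (1 : ℝ) ≤ t := by exact_mod_cast ht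
  have hFpos : 0 < rho (extremalGraph n t) := by
    have : (t : ℝ) < n := by exact_mod_cast (by omega : t < n)
    have : 0 < rho (extremalGraph n t) ^ 2 := lt_of_lt_of_le (by
      apply mul_pos <;> linarith) hFsq
    exact lt_of_le_of_ne hF0 (fun h => by rw [← h] at this; norm_num at this)
  have hT : ∀ v ∉ L, ∑ w ∈ nbr G v \ L, x w ≤ 1 / 4 := fun v hv =>
    sum_nbr_outside_le hG ht hL hdeg hn (exists_perron G).1
      (hFsq.trans (pow_le_pow_left₀ hF0 hrho 2)) hx0 hx1 hx hv
  -- the vertices outside `L` adjacent to all of `L` induce a graph of maximum degree one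
  set S : Finset V := univ.filter (fun v => v ∉ L ∧ L ⊆ nbr G v) with hS
  set M : SimpleGraph V := SimpleGraph.mk (fun u w => G.Adj u w ∧ u ∈ S ∧ w ∈ S)
    ⟨fun _ _ h => ⟨h.1.symm, h.2.2, h.2.1⟩⟩ ⟨fun _ h => h.1.ne rfl⟩ with hM
  obtain ⟨f, hinj, hlt, hf⟩ := exists_matching_labelling (M := M) Lᶜ (by
    intro b hb a ha c hc hab hbc
    by_contra hac
    have ha' := (mem_filter.1 hab.2.1).2
    have hc' := (mem_filter.1 hbc.2.2).2
    exact not_fourCycle_of_large hG hL hdeg4 hn8 hl₀ ha'.1 (mem_compl.1 hb) hc'.1 hac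
      (mem_nbr.1 (ha'.2 hl₀)).symm hab.1 hbc.1 (mem_nbr.1 (hc'.2 hl₀)))
  rw [card_compl, hL] at hlt
  obtain ⟨e⟩ := nonempty_iso_extremalGraph (n := n) (t := t) rfl hL hinj hlt
  have hSL : ∀ v ∈ S, v ∈ Lᶜ := fun v hv => mem_compl.2 (mem_filter.1 hv).2.1
  have hgain := sum_le_quad_labelledExtremal_sub_quad (G := G) (L := L) (f := f) hx0 hxL
    (fun a ha b hb hab => hf a (hSL a ha) b (hSL b hb) ⟨hab, ha, hb⟩) hT
  set F := labelledExtremal L f with hFdef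
  set B : Finset V := univ.filter (fun v => v ∉ L ∧ ¬ L ⊆ nbr G v) with hB
  have hBnn : 0 ≤ ∑ v ∈ B, x v := sum_nonneg fun v _ => hx0 v
  have hqG : quad G x = rho G * ∑ u, x u ^ 2 := by
    rw [quad, mul_sum]
    refine sum_congr rfl fun u _ => ?_
    rw [nbrSum, ← hx]; ring
  have hrayF : ∀ y, quad F y ≤ rho (extremalGraph n t) * ∑ u, y u ^ 2 := quad_le_of_iso e
  have hsq : 0 ≤ ∑ u, x u ^ 2 := sum_nonneg fun u _ => sq_nonneg _
  have hmul := mul_le_mul_of_nonneg_right hrho hsq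
  have hrayx := hrayF x
  -- `x` attains the maximal Rayleigh quotient of `F`, hence is its eigenvector and positive
  have hqF : quad F x = rho (extremalGraph n t) * ∑ u, x u ^ 2 := by linarith
  have hB0 : ∑ v ∈ B, x v = 0 := by linarith
  have heigF := nbrSum_eq_of_quad_eq hrayF hqF
  have hxpos : ∀ v, 0 < x v := by
    intro v
    by_cases hv : v ∈ L
    · linarith [hxL v hv]
    · have h1 : x l₀ ≤ nbrSum F x v := by
        refine single_le_sum (fun w _ => hx0 w) (mem_nbr.2 ?_)
        exact ⟨fun h => hv (h ▸ hl₀), Or.inr (Or.inl hl₀)⟩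
      rw [heigF] at h1
      have h2 := hxL l₀ hl₀
      by_contra hneg
      have h3 : x v = 0 := le_antisymm (not_lt.1 hneg) (hx0 v)
      rw [h3, mul_zero] at h1
      linarith
  have hBempty : ∀ v, v ∉ L → L ⊆ nbr G v := by
    intro v hv
    by_contra hvL
    have hvB : v ∈ B := mem_filter.2 ⟨mem_univ v, hv, hvL⟩
    have := (sum_eq_zero_iff_of_nonneg (fun v _ => hx0 v)).1 hB0 v hvB
    exact (hxpos v).ne' this
  have hle : ∀ u w, G.Adj u w → F.Adj u w := by
    intro u w huw
    by_cases hu : u ∈ L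
    · exact ⟨huw.ne, Or.inl hu⟩
    by_cases hw : w ∈ L
    · exact ⟨huw.ne, Or.inr (Or.inl hw)⟩
    have huS : u ∈ S := mem_filter.2 ⟨mem_univ u, hu, hBempty u hu⟩
    have hwS : w ∈ S := mem_filter.2 ⟨mem_univ w, hw, hBempty w hw⟩
    exact ⟨huw.ne, Or.inr (Or.inr (hf u (hSL u huS) w (hSL w hwS) ⟨huw, huS, hwS⟩))⟩
  have hqle : quad F x ≤ quad G x := by linarith
  have hsub : ∀ u, nbr G u ⊆ nbr F u := fun u w hw => mem_nbr.2 (hle u w (mem_nbr.1 hw))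
  have hGF : G = F := by
    ext u w
    refine ⟨hle u w, fun huw => ?_⟩
    by_contra hGuw
    have hstep : ∀ v, x v * nbrSum G x v ≤ x v * nbrSum F x v := fun v =>
      mul_le_mul_of_nonneg_left (sum_le_sum_of_subset_of_nonneg (hsub v) fun y _ _ => hx0 y) (hx0 v)
    refine absurd hqle (not_le.2 (sum_lt_sum (fun v _ => hstep v) ⟨u, mem_univ u, ?_⟩))
    refine mul_lt_mul_of_pos_left ?_ (hxpos u)
    exact sum_lt_sum_of_subset (hsub u) (mem_nbr.2 huw) (by simpa using hGuw) (hxpos w)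
      fun y _ _ => hx0 y
  rw [hGF]
  exact ⟨e⟩

end Stability

/-! ### Vertices of large Perron weight when `t ≥ 2` -/

section LargeVertices

variable {V : Type*} [Fintype V] {G : SimpleGraph V} {t : ℕ}

open Classical in
lemma sq_mul_eq_sum_sum {ρ : ℝ} {x : V → ℝ} (hx : ∀ u, ρ * x u = ∑ v ∈ nbr G u, x v) (u : V) :
    ρ ^ 2 * x u = ∑ w ∈ nbr G u, ∑ y ∈ nbr G w, x y := by
  rw [sq, mul_assoc, hx, mul_sum]
  exact sum_congr rfl fun w _ => hx w

open Classical in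
lemma rho_sq_le (hG : ¬ (intersectingFourCycles t).IsContained G) {ρ : ℝ} {x : V → ℝ}
    (hx1 : ∀ v, x v ≤ 1) (hx : ∀ u, ρ * x u = ∑ v ∈ nbr G u, x v) {z : V} (hz : x z = 1) :
    ρ ^ 2 ≤ (6 * t + 3) * Fintype.card V := by
  have h1 := sq_mul_eq_sum_sum hx z
  rw [hz, mul_one] at h1
  have h2 := two_walks_le hG z univ
  simp only [inter_univ, card_univ] at h2
  rw [h1]
  refine le_trans (sum_le_sum fun w _ => ?_) h2
  refine (sum_le_card_nsmul _ _ 1 fun y _ => hx1 y).trans ?_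
  simp

open Classical in
/-- For `t ≥ 2` the vertices of large degree are the only ones of large Perron weight, and `t` of
them are adjacent to almost everything. Walks of length two from `u` that do not end in the
bounded set `D` of vertices of degree at least `δ n` contribute at most about `n` times the maximum
`M` of `x` outside `D` to `ρ² x u`. As `ρ²` is about `t n` with `t ≥ 2`, this makes `M` small, so
`ρ² x u` is nearly the weight of the walks from `u` to `D`, and for a maximum `u` of `x` almost all
neighbours of `u` must have `t` neighbours of almost full weight in `D`. -/
lemma exists_large_vertices (ht : 2 ≤ t) (hG : ¬ (intersectingFourCycles t).IsContained G)
    {ρ : ℝ} (hρ0 : 0 ≤ ρ) (hρ : (t : ℝ) * (Fintype.card V - t) ≤ ρ ^ 2) {x : V → ℝ}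
    (hx0 : ∀ v, 0 ≤ x v) (hx1 : ∀ v, x v ≤ 1) (hx : ∀ u, ρ * x u = ∑ v ∈ nbr G u, x v)
    {z : V} (hz : x z = 1) {ε δ : ℝ} {K : ℕ} (hε : ε ≤ 1 / 2) (hδ0 : 0 < δ)
    (hδ : (20 * t + 11) * δ ≤ ε) (hK : (t : ℝ) + 1 ≤ K * δ)
    (hn1 : (K : ℝ) * (2 ^ K * (3 * t + 1)) ≤ δ * Fintype.card V)
    (hn2 : (K : ℝ) * (2 ^ K * (3 * t + 1)) < Fintype.card V)
    (hn3 : 6 * (t : ℝ) + 3 ≤ δ ^ 2 * Fintype.card V) (hn4 : (t : ℝ) ^ 2 ≤ δ * Fintype.card V)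
    (hn5 : 2 * (t : ℝ) ^ 2 ≤ Fintype.card V) :
    ∃ L : Finset V, L.card = t ∧ ∀ l ∈ L, 1 / 2 ≤ x l ∧
      ((nbr G l)ᶜ.card : ℝ) ≤ 2 * ε * Fintype.card V := by
  set n : ℝ := ((Fintype.card V : ℕ) : ℝ) with hndef
  have htr : (2 : ℝ) ≤ t := by exact_mod_cast ht
  have hnpos : 0 < n := lt_of_lt_of_le (by positivity) hn5
  set D : Finset V := univ.filter fun v => δ * n ≤ ((nbr G v).card : ℝ) with hD
  have hDK : D.card < K := card_large_degree_lt hG hK hn2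
  have hDsum : ∀ A : Finset V, ∑ w ∈ A, ((nbr G w ∩ D).card : ℝ) ≤ t * A.card + δ * n := by
    intro A
    refine (sum_card_inter_le hG D A).trans ?_
    refine add_le_add le_rfl (le_trans ?_ hn1)
    have h1 : (D.card : ℝ) ≤ K := by exact_mod_cast hDK.le
    gcongr
    · norm_num
  have hinner : ∀ w, ∑ y ∈ nbr G w ∩ D, x y ≤ ((nbr G w ∩ D).card : ℝ) := fun w => by
    refine (sum_le_card_nsmul _ _ 1 fun y _ => hx1 y).trans ?_
    simp
  have hρδ : ρ ≤ δ * n := by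
    refine le_of_sq_le_sq ?_ (by positivity)
    refine (rho_sq_le hG hx1 hx hz).trans ?_
    calc (6 * (t : ℝ) + 3) * n ≤ δ ^ 2 * n * n := by gcongr
      _ = (δ * n) ^ 2 := by ring
  -- the maximum `M` of `x` outside `D`
  have hKn : K ≤ Fintype.card V := by
    have h1 : (K : ℝ) ≤ K * (2 ^ K * (3 * t + 1)) := by
      have h2 : (1 : ℝ) ≤ 2 ^ K := one_le_pow₀ (by norm_num)
      have h3 : (1 : ℝ) ≤ 2 ^ K * (3 * t + 1) := by nlinarith
      nlinarith [(Nat.cast_nonneg K : (0 : ℝ) ≤ K)]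
    have h2 : (K : ℝ) ≤ Fintype.card V := h1.trans hn2.le
    exact_mod_cast h2
  have hne : (univ \ D).Nonempty := by
    rw [← card_pos, ← compl_eq_univ_sdiff, card_compl]
    omega
  obtain ⟨p, hp, hpmax⟩ := exists_max_image (univ \ D) x hne
  have hpD : p ∉ D := (mem_sdiff.1 hp).2
  set M := x p with hM
  have hM0 : 0 ≤ M := hx0 p
  have hwalk : ∀ u, ρ ^ 2 * x u ≤ ∑ w ∈ nbr G u, ∑ y ∈ nbr G w ∩ D, x y
      + (6 * t + 2) * (δ * n) + n * M := by
    intro u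
    set f : V → ℝ := fun y => if y ∈ D then 0 else x y with hf
    have hf0 : ∀ y, 0 ≤ f y := fun y => by
      simp only [hf]; split_ifs
      exacts [le_rfl, hx0 y]
    have hfx : ∀ y, f y ≤ x y := fun y => by
      simp only [hf]; split_ifs
      exacts [hx0 y, le_rfl]
    have hsplit : ∀ w, ∑ y ∈ nbr G w, x y = ∑ y ∈ nbr G w ∩ D, x y + ∑ y ∈ nbr G w, f y := by
      intro w
      rw [← filter_mem_eq_inter, sum_filter, ← sum_add_distrib]
      refine sum_congr rfl fun y _ => ?_
      simp only [hf]; split_ifs <;> simp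
    obtain ⟨S, hS, hb⟩ := exists_two_walk_bound hG u
    have h := hb univ f hf0
    have hSr : (S.card : ℝ) ≤ 3 * t + 1 := by exact_mod_cast hS
    have hδn : 0 ≤ δ * n := by positivity
    simp only [inter_univ] at h
    have h1 : ∑ w ∈ S, ∑ y ∈ nbr G w, f y ≤ (3 * t + 1) * (δ * n) := by
      refine (sum_le_card_nsmul _ _ (δ * n) fun w _ => ?_).trans ?_
      · calc ∑ y ∈ nbr G w, f y ≤ ∑ y ∈ nbr G w, x y := sum_le_sum fun y _ => hfx y
          _ = ρ * x w := (hx w).symm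
          _ ≤ ρ * 1 := mul_le_mul_of_nonneg_left (hx1 w) hρ0
          _ ≤ δ * n := by linarith
      · rw [nsmul_eq_mul]; gcongr
    have h2 : ∑ y ∈ S, ((nbr G y).card : ℝ) * f y ≤ (3 * t + 1) * (δ * n) := by
      refine (sum_le_card_nsmul _ _ (δ * n) fun y _ => ?_).trans ?_
      · by_cases hy : y ∈ D
        · simp only [hf, hy, if_true, mul_zero]; exact hδn
        · have h3 : ((nbr G y).card : ℝ) ≤ δ * n := by
            by_contra h4
            exact hy (mem_filter.2 ⟨mem_univ y, (not_le.1 h4).le⟩)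
          calc ((nbr G y).card : ℝ) * f y ≤ ((nbr G y).card : ℝ) * 1 :=
                mul_le_mul_of_nonneg_left ((hfx y).trans (hx1 y)) (by positivity)
            _ ≤ δ * n := by linarith
      · rw [nsmul_eq_mul]; gcongr
    have h3 : ∑ y, f y ≤ n * M := by
      refine (sum_le_card_nsmul _ _ M fun y _ => ?_).trans ?_
      · simp only [hf]; split_ifs with hy
        exacts [hM0, hpmax y (by simpa using hy)]
      · rw [nsmul_eq_mul, card_univ]
    rw [sq_mul_eq_sum_sum hx]
    simp only [hsplit, sum_add_distrib]
    linarith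
  have hDd : ∀ u, ∑ w ∈ nbr G u, ∑ y ∈ nbr G w ∩ D, x y ≤ t * ((nbr G u).card : ℝ) + δ * n :=
    fun u => (sum_le_sum fun w _ => hinner w).trans (hDsum _)
  -- here `t ≥ 2` enters: the term `n M` is absorbed by `ρ ^ 2 * M`, which is about `t n M`
  have hMsmall : M ≤ 2 * (7 * t + 3) * δ := by
    have h1 := hwalk p
    have h2 := hDd p
    have h3 : ((nbr G p).card : ℝ) ≤ δ * n := by
      by_contra h4
      exact hpD (mem_filter.2 ⟨mem_univ p, (not_le.1 h4).le⟩)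
    have h4 := mul_le_mul_of_nonneg_right hρ hM0
    have h5 : (t : ℝ) * ((nbr G p).card : ℝ) ≤ t * (δ * n) := by gcongr
    have h6 : (n / 2) * M ≤ (t * (n - t) - n) * M := by
      refine mul_le_mul_of_nonneg_right ?_ hM0
      nlinarith
    have h7 : n * M ≤ n * (2 * (7 * t + 3) * δ) := by nlinarith
    exact le_of_mul_le_mul_left h7 hnpos
  have hmain : ∀ u, ρ ^ 2 * x u ≤ ∑ w ∈ nbr G u, ∑ y ∈ nbr G w ∩ D, x y
      + (20 * t + 8) * δ * n := by
    intro u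
    have h1 := hwalk u
    have h2 : n * M ≤ n * (2 * (7 * t + 3) * δ) := by gcongr
    linarith
  have hδn : 0 < δ * n := by positivity
  have hδn' : (20 * t + 11) * δ * n ≤ ε * n := by gcongr
  -- otherwise the walks from the maximum `z` to `D` would carry weight less than `ρ ^ 2`
  obtain ⟨w, hw1, hw2⟩ : ∃ w, (nbr G w ∩ D).card ≤ t ∧ t - ε ≤ ∑ y ∈ nbr G w ∩ D, x y := by
    by_contra! hcon
    have h1 := hmain z
    rw [hz, mul_one] at h1
    have h2 : ∑ w ∈ nbr G z, ∑ y ∈ nbr G w ∩ D, x y ≤ (t - ε) * n + δ * n := by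
      have h3 : ∀ w ∈ nbr G z, ∑ y ∈ nbr G w ∩ D, x y ≤
          (t - ε) + if t < (nbr G w ∩ D).card then (K : ℝ) else 0 := by
        intro w _
        split_ifs with hw
        · have h4 := hinner w
          have h5 : ((nbr G w ∩ D).card : ℝ) ≤ K := by
            exact_mod_cast (card_le_card inter_subset_right).trans hDK.le
          linarith
        · linarith [hcon w (not_lt.1 hw)]
      refine (sum_le_sum h3).trans ?_
      rw [sum_add_distrib, sum_const, nsmul_eq_mul, ← sum_filter, sum_const, nsmul_eq_mul]
      refine add_le_add ?_ (le_trans ?_ hn1)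
      · rw [mul_comm]
        refine mul_le_mul_of_nonneg_left ?_ (by linarith)
        rw [hndef]; exact_mod_cast card_le_univ _
      · have h4 : ((nbr G z).filter fun w => t < (nbr G w ∩ D).card).card ≤
            2 ^ K * (3 * t + 1) := by
          refine (card_le_card (filter_subset_filter _ (subset_univ _))).trans
            ((card_many_nbrs_le hG D).trans ?_)
          gcongr
          norm_num
        rw [mul_comm]
        refine mul_le_mul_of_nonneg_left ?_ (by positivity)
        exact_mod_cast h4
    nlinarith
  set L := nbr G w ∩ D with hL
  have hε0 : 0 < ε := lt_of_lt_of_le (by positivity) hδ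
  have hLcard : L.card = t := by
    refine le_antisymm hw1 ?_
    by_contra hlt
    push Not at hlt
    have h1 : (L.card : ℝ) + 1 ≤ t := by exact_mod_cast hlt
    linarith [hinner w]
  refine ⟨L, hLcard, fun l hl => ?_⟩
  have hxl : 1 - ε ≤ x l := by
    have h1 := sum_erase_add L x hl
    have h2 : ∑ y ∈ L.erase l, x y ≤ t - 1 := by
      refine (sum_le_card_nsmul _ _ 1 fun y _ => hx1 y).trans ?_
      rw [card_erase_of_mem hl, hLcard, nsmul_eq_mul, mul_one, Nat.cast_sub (by omega)]
      simp
    linarith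
  refine ⟨by linarith, ?_⟩
  have h1 := (hmain l).trans (add_le_add_left (hDd l) _)
  have h2 : t * (n - t) * (1 - ε) ≤ ρ ^ 2 * x l :=
    mul_le_mul hρ hxl (by linarith) (by positivity)
  have h3 : ((nbr G l)ᶜ.card : ℝ) = n - (nbr G l).card := by
    rw [card_compl, Nat.cast_sub (card_le_univ _)]
  rw [h3]
  have h4 : (t : ℝ) * (n - (nbr G l).card) ≤ t * (2 * ε * n) := by
    have h5 : 0 ≤ ε * (t : ℝ) ^ 2 := by positivity
    have h6 : 1 * (ε * n) ≤ t * (ε * n) := by gcongr; linarith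
    have h7 : t * (n - t) * (1 - ε) = t * n - t ^ 2 - t * (ε * n) + ε * t ^ 2 := by ring
    linarith
  exact le_of_mul_le_mul_left h4 (by linarith)

end LargeVertices

/-! ### The friendship theorem for regular graphs -/

section Friendship

variable {V : Type*} [Fintype V] {G : SimpleGraph V}

open Classical in
/-- The friendship theorem for regular graphs. Modulo a prime divisor `p` of `d - 1` the adjacency
matrix satisfies `A ^ k = J` for `k ≥ 2`, and the traces of `A ^ p` and `A` contradict Frobenius. -/
lemma not_friendship_of_regular {d : ℕ} (hd : 3 ≤ d) (hdeg : ∀ v, (nbr G v).card = d)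
    (hfr : ∀ u v, u ≠ v → (nbr G u ∩ nbr G v).card = 1) (hn : Fintype.card V = d * (d - 1) + 1) :
    False := by
  set p := (d - 1).minFac with hp
  have hprime : p.Prime := Nat.minFac_prime (by omega)
  have : Fact p.Prime := ⟨hprime⟩
  have hd1 : ((d - 1 : ℕ) : ZMod p) = 0 := (ZMod.natCast_eq_zero_iff _ _).2 (Nat.minFac_dvd _)
  have hd2 : (d : ZMod p) = 1 := by
    have h : ((d - 1 + 1 : ℕ) : ZMod p) = d := by congr 1; omega
    rw [← h, Nat.cast_add, hd1]; simp
  set A : Matrix V V (ZMod p) := G.adjMatrix (ZMod p) with hA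
  set J : Matrix V V (ZMod p) := Matrix.of fun _ _ => 1 with hJ
  have hAapp : ∀ u v, A u v = if G.Adj u v then 1 else 0 := fun u v => by
    simp [hA, SimpleGraph.adjMatrix_apply]
  have hcard : ∀ u, ((univ.filter (G.Adj u)).card) = d := fun u => by rw [← hdeg u, nbr]
  have hAA : A * A = J := by
    ext u v
    rw [Matrix.mul_apply]
    have : ∑ w, A u w * A w v = ((nbr G u ∩ nbr G v).card : ZMod p) := by
      rw [← filter_mem_eq_inter, card_filter, nbr, sum_filter]
      push_cast
      refine sum_congr rfl fun w _ => ?_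
      rw [hAapp, hAapp]
      simp only [mem_nbr, G.adj_comm w v]
      split_ifs <;> simp
    rw [this]
    by_cases huv : u = v
    · subst huv; rw [inter_self, hdeg, hd2]; simp [hJ]
    · rw [hfr u v huv]; simp [hJ]
  have hAJ : J * A = J := by
    ext u v
    rw [Matrix.mul_apply]
    have : ∑ w, J u w * A w v = ((univ.filter (G.Adj v)).card : ZMod p) := by
      rw [card_filter]; push_cast
      refine sum_congr rfl fun w _ => ?_
      rw [hAapp]; simp [hJ, G.adj_comm w v]
    rw [this, hcard, hd2]; simp [hJ]
  have hpow : ∀ k, A ^ (k + 2) = J := by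
    intro k
    induction k with
    | zero => rw [zero_add, sq, hAA]
    | succ k ih => rw [show k + 1 + 2 = (k + 2) + 1 by ring, pow_succ, ih, hAJ]
  have htr := ZMod.trace_pow_card A
  obtain ⟨k, hk⟩ : ∃ k, p = k + 2 := ⟨p - 2, by have := hprime.two_le; omega⟩
  have h1 : A ^ p = J := by
    have h := hpow k
    rwa [← hk] at h
  have h2 : A.trace = 0 := by simp [Matrix.trace, hAapp]
  rw [h1, h2, zero_pow hprime.ne_zero] at htr
  have h3 : J.trace = 1 := by
    simp only [Matrix.trace, Matrix.diag, hJ, Matrix.of_apply, sum_const, card_univ, hn]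
    simp [hd1]
  rw [h3] at htr
  exact one_ne_zero htr

end Friendship

/-! ### The spectral radius of the extremal graph for `t = 1` -/

section FriendshipGraph

open Classical in
/-- The bound comes from the test vector equal to `1` at the centre, to `1 / (ρ - 1)` on matched
and to `1 / ρ` on unmatched vertices, which is an eigenvector up to the equation at the centre. -/
lemma le_rho_extremalGraph_one {n : ℕ} (hn : 3 ≤ n) :
    ∃ γ : ℕ, γ ≤ 1 ∧ (Odd n → γ = 0) ∧ (n : ℝ) - 1 - γ / rho (extremalGraph n 1) ≤
      rho (extremalGraph n 1) ^ 2 - rho (extremalGraph n 1) := by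
  have : Nonempty (Fin 1 ⊕ Fin (n - 1)) := ⟨Sum.inl 0⟩
  obtain ⟨h0, -, hray, -⟩ := exists_perron (extremalGraph n 1)
  have hsq := le_rho_extremalGraph_sq (n := n) le_rfl (by omega)
  set ρ := rho (extremalGraph n 1) with hρ
  have hnr : (3 : ℝ) ≤ n := by exact_mod_cast hn
  have hρ1 : 1 < ρ := by
    by_contra h
    push_cast at hsq
    nlinarith [not_lt.1 h]
  set I : Finset (Fin (n - 1)) := univ.filter fun j => ∀ j', ¬ (maxMatching (n - 1)).Adj j j'
  have hI : ∀ j ∈ I, (j : ℕ) = n - 2 ∧ ¬ Odd n := by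
    intro j hj
    have hj' := (mem_filter.1 hj).2
    have hlt := j.2
    rcases Nat.even_or_odd' (j : ℕ) with ⟨k, hk | hk⟩
    · by_cases hlast : (j : ℕ) + 1 < n - 1
      · refine absurd ⟨?_, ?_⟩ (hj' ⟨j + 1, hlast⟩)
        · intro h
          have := congrArg Fin.val h
          simp at this
        · change (j : ℕ) / 2 = ((j : ℕ) + 1) / 2
          omega
      · refine ⟨by omega, ?_⟩
        rintro ⟨m, hm⟩
        omega
    · refine absurd ⟨?_, ?_⟩ (hj' ⟨j - 1, by omega⟩)
      · intro h
        have := congrArg Fin.val h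
        simp only at this
        omega
      · change (j : ℕ) / 2 = ((j : ℕ) - 1) / 2
        omega
  have hI1 : I.card ≤ 1 := card_le_one.2 fun a ha b hb =>
    Fin.ext ((hI a ha).1.trans (hI b hb).1.symm)
  refine ⟨I.card, hI1, fun hodd => card_eq_zero.2 (eq_empty_of_forall_notMem fun j hj =>
    (hI j hj).2 hodd), ?_⟩
  set p := 1 / (ρ - 1) with hp
  set q := 1 / ρ with hq
  have hp0 : 0 < p := by rw [hp]; apply one_div_pos.2; linarith
  have hq0 : 0 < q := by rw [hq]; apply one_div_pos.2; linarith
  have hpe : ρ * p = 1 + p := by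
    have : ρ - 1 ≠ 0 := by linarith
    rw [hp]; field_simp; ring
  have hqe : ρ * q = 1 := by
    have : ρ ≠ 0 := by linarith
    rw [hq]; field_simp
  set w : Fin (n - 1) → ℝ := fun j => if j ∈ I then q else p with hw
  have hw0 : ∀ j, 0 < w j := fun j => by simp only [hw]; split_ifs <;> assumption
  set y : Fin 1 ⊕ Fin (n - 1) → ℝ := Sum.elim (fun _ => 1) w with hy
  have hy0 : ∀ v, 0 ≤ y v := by
    rintro (i | j)
    · simp [hy]
    · exact (hw0 j).le
  have hcentre : ∑ j, w j ≤ nbrSum (extremalGraph n 1) y (Sum.inl 0) := by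
    have : ∑ v ∈ (univ : Finset (Fin (n - 1))).map Function.Embedding.inr, y v = ∑ j, w j := by
      simp [hy]
    rw [← this]
    refine sum_le_sum_of_subset_of_nonneg ?_ fun v _ _ => hy0 v
    intro v hv
    obtain ⟨j, -, rfl⟩ := mem_map.1 hv
    exact mem_nbr.2 (extremalGraph_adj_inl_inr 0 j)
  have hother : ∀ j, ρ * w j ≤ nbrSum (extremalGraph n 1) y (Sum.inr j) := by
    intro j
    have hmem : (Sum.inl 0 : Fin 1 ⊕ Fin (n - 1)) ∈ nbr (extremalGraph n 1) (Sum.inr j) :=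
      mem_nbr.2 (extremalGraph_adj_inl_inr 0 j).symm
    by_cases hj : j ∈ I
    · have h1 : ρ * w j = y (Sum.inl 0) := by simp [hw, hj, hqe, hy]
      rw [h1]
      exact single_le_sum (fun v _ => hy0 v) hmem
    · have hj' := hj
      simp only [I, mem_filter, mem_univ, true_and, not_forall, not_not] at hj'
      obtain ⟨j', hjj'⟩ := hj'
      have hI' : j' ∉ I := fun h => (mem_filter.1 h).2 j hjj'.symm
      have h1 : ρ * w j = ∑ v ∈ {Sum.inl 0, Sum.inr j'}, y v := by
        rw [sum_pair (by simp)]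
        simp [hw, hj, hI', hpe, hy]
      rw [h1]
      refine sum_le_sum_of_subset_of_nonneg ?_ fun v _ _ => hy0 v
      intro v hv
      rcases mem_insert.1 hv with rfl | hv
      · exact hmem
      · rw [mem_singleton.1 hv, mem_nbr, extremalGraph_adj_inr_inr]
        exact hjj'
  have hquad := hray y
  rw [quad, Fintype.sum_sum_type, Fintype.sum_sum_type] at hquad
  simp only [univ_unique, sum_singleton, Fin.default_eq_zero] at hquad
  have e1 : y (Sum.inl 0) = 1 := rfl
  have e2 : ∀ j, y (Sum.inr j) = w j := fun _ => rfl
  simp only [e1, e2, one_pow, one_mul] at hquad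
  have h1 : ρ * ∑ j, w j ^ 2 ≤ ∑ j, w j * nbrSum (extremalGraph n 1) y (Sum.inr j) := by
    rw [mul_sum]
    refine sum_le_sum fun j _ => ?_
    have := mul_le_mul_of_nonneg_left (hother j) (hw0 j).le
    linarith
  -- the squares of the entries outside the centre cancel
  have h2 : ∑ j, w j ≤ ρ := by linarith
  have hcardI : ((Iᶜ.card : ℕ) : ℝ) = n - 1 - I.card := by
    rw [card_compl, Fintype.card_fin, Nat.cast_sub (by
      have := card_le_univ I
      rwa [Fintype.card_fin] at this), Nat.cast_sub (by omega)]
    simp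
  have h3 : ∑ j, w j = I.card * q + (n - 1 - I.card) * p := by
    rw [← sum_add_sum_compl I]
    congr 1
    · rw [sum_congr rfl (fun j hj => by simp only [hw, if_pos hj] : ∀ j ∈ I, w j = q), sum_const,
        nsmul_eq_mul]
    · rw [sum_congr rfl (fun j hj => by simp only [hw, if_neg (mem_compl.1 hj)] :
        ∀ j ∈ Iᶜ, w j = p), sum_const, nsmul_eq_mul, hcardI]
  rw [h3, hp, hq] at h2
  have hρ0 : 0 < ρ := by linarith
  have hρ2 : 0 < ρ - 1 := by linarith
  have h4 := mul_le_mul_of_nonneg_right h2 hρ2.le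
  have h5 : ((I.card : ℝ) * (1 / ρ) + (n - 1 - I.card) * (1 / (ρ - 1))) * (ρ - 1)
      = n - 1 - I.card / ρ := by field_simp; ring
  rw [h5] at h4
  linarith

end FriendshipGraph

/-! ### Four-cycle-free graphs: codegrees and deficits -/

section FourCycleFree

variable {V : Type*} [Fintype V] {G : SimpleGraph V}

open Classical in
lemma codeg_le_one (hG : ¬ (intersectingFourCycles 1).IsContained G) {u v : V} (huv : u ≠ v) :
    (nbr G u ∩ nbr G v).card ≤ 1 := by
  rw [card_le_one]
  intro a ha c hc
  by_contra hac
  simp only [mem_inter, mem_nbr] at ha hc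
  refine hG (isContained_of_packs (u := u) ⟨a, v, c, ?_, ?_, ?_, hac, ha.1, ha.2.symm, hc.2,
    hc.1.symm, trivial⟩)
  · simpa using ha.1.ne'
  · simpa using huv.symm
  · simpa using hc.1.ne'

open Classical in
/-- The share of `v` in the amount by which `(ρ² - ρ) x u` falls short of `n - 1`: this amount is
the sum of the deficits over `v ≠ u` plus `d(u) (1 - x u)` (see `sum_deficit_eq`). Without
four-cycles all deficits are nonnegative. -/
noncomputable def deficit (G : SimpleGraph V) (x : V → ℝ) (u v : V) : ℝ :=
  if G.Adj u v then (1 - ((nbr G u ∩ nbr G v).card : ℝ)) * x v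
  else 1 - ((nbr G u ∩ nbr G v).card : ℝ) * x v

lemma deficit_nonneg (hG : ¬ (intersectingFourCycles 1).IsContained G) {x : V → ℝ}
    (hx0 : ∀ v, 0 ≤ x v) (hx1 : ∀ v, x v ≤ 1) {u v : V} (huv : u ≠ v) : 0 ≤ deficit G x u v := by
  classical
  have h1 : ((nbr G u ∩ nbr G v).card : ℝ) ≤ 1 := by exact_mod_cast codeg_le_one hG huv
  have h0 := hx0 v
  have h2 := hx1 v
  unfold deficit
  split_ifs
  · exact mul_nonneg (by linarith) h0
  · nlinarith

lemma le_deficit_of_not_adj (hG : ¬ (intersectingFourCycles 1).IsContained G) {x : V → ℝ}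
    (hx0 : ∀ v, 0 ≤ x v) {u v : V} (huv : u ≠ v) (h : ¬ G.Adj u v) :
    1 - x v ≤ deficit G x u v := by
  classical
  have h1 : ((nbr G u ∩ nbr G v).card : ℝ) ≤ 1 := by exact_mod_cast codeg_le_one hG huv
  rw [deficit, if_neg h]
  nlinarith [hx0 v]

open Classical in
lemma codeg_eq_one_of_deficit_lt (hG : ¬ (intersectingFourCycles 1).IsContained G) {x : V → ℝ}
    (hx1 : ∀ v, x v ≤ 1) {u v : V} (huv : u ≠ v) (h : deficit G x u v < x v) :
    (nbr G u ∩ nbr G v).card = 1 := by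
  refine le_antisymm (codeg_le_one hG huv) ?_
  by_contra h0
  have h0 : (nbr G u ∩ nbr G v).card = 0 := by omega
  unfold deficit at h
  rw [h0] at h
  have := hx1 v
  split_ifs at h <;> simp at h
  linarith

open Classical in
lemma sum_deficit_eq {ρ : ℝ} {x : V → ℝ} (hx : ∀ u, ρ * x u = ∑ v ∈ nbr G u, x v) (u : V) :
    ∑ v ∈ univ.erase u, deficit G x u v = (Fintype.card V - 1)
      - ((nbr G u).card : ℝ) * (1 - x u) - (ρ ^ 2 - ρ) * x u := by
  have h1 : ρ ^ 2 * x u = ∑ v, ((nbr G v ∩ nbr G u).card : ℝ) * x v := by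
    rw [sq_mul_eq_sum_sum hx, sum_nbr_inter_comm]
  rw [← sum_erase_add univ _ (mem_univ u), inter_self] at h1
  have h2 : ρ * x u = ∑ v ∈ univ.erase u, if G.Adj u v then x v else 0 := by
    rw [hx, ← sum_filter]
    refine sum_congr ?_ fun _ _ => rfl
    ext v
    simp only [mem_nbr, mem_filter, mem_erase, mem_univ, and_true]
    exact ⟨fun h => ⟨h.ne', h⟩, fun h => h.2⟩
  have h3 : ((nbr G u).card : ℝ) = ∑ v ∈ univ.erase u, if G.Adj u v then 1 else 0 := by
    rw [← sum_filter, sum_const, nsmul_eq_mul, mul_one]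
    congr 2
    ext v
    simp only [mem_nbr, mem_filter, mem_erase, mem_univ, and_true]
    exact ⟨fun h => ⟨h.ne', h⟩, fun h => h.2⟩
  have h4 : (Fintype.card V : ℝ) - 1 = ∑ v ∈ univ.erase u, (1 : ℝ) := by
    rw [sum_const, card_erase_of_mem (mem_univ u), card_univ, nsmul_eq_mul, mul_one, Nat.cast_sub
      (Fintype.card_pos_iff.2 ⟨u⟩)]
    simp
  have h5 : ∑ v ∈ univ.erase u, deficit G x u v = (Fintype.card V - 1) - ((nbr G u).card : ℝ)
      - ∑ v ∈ univ.erase u, ((nbr G v ∩ nbr G u).card : ℝ) * x v + ρ * x u := by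
    rw [h2, h3, h4, ← sum_sub_distrib, ← sum_sub_distrib, ← sum_add_distrib]
    refine sum_congr rfl fun v _ => ?_
    rw [deficit, inter_comm]
    split_ifs <;> ring
  linarith

open Classical in
/-- The deficits at `u` add up to at most `n (1 - x u) + ε` when `ρ² - ρ ≥ n - 1 - ε`. -/
lemma sum_deficit_le {ρ ε : ℝ} {x : V → ℝ} (hx0 : ∀ v, 0 ≤ x v) (hx1 : ∀ v, x v ≤ 1) (hε0 : 0 ≤ ε)
    (hx : ∀ u, ρ * x u = ∑ v ∈ nbr G u, x v)
    (hρ : (Fintype.card V : ℝ) - 1 - ε ≤ ρ ^ 2 - ρ) (u : V) :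
    ∑ v ∈ univ.erase u, deficit G x u v ≤ Fintype.card V * (1 - x u) + ε := by
  rw [sum_deficit_eq hx]
  have h6 : 0 ≤ ((nbr G u).card : ℝ) * (1 - x u) :=
    mul_nonneg (by positivity) (by linarith [hx1 u])
  have h7 := mul_le_mul_of_nonneg_right hρ (hx0 u)
  have h8 := hx1 u
  nlinarith

open Classical in
lemma deficit_le (hG : ¬ (intersectingFourCycles 1).IsContained G) {ρ ε : ℝ} {x : V → ℝ}
    (hx0 : ∀ v, 0 ≤ x v) (hx1 : ∀ v, x v ≤ 1) (hε0 : 0 ≤ ε)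
    (hx : ∀ u, ρ * x u = ∑ v ∈ nbr G u, x v)
    (hρ : (Fintype.card V : ℝ) - 1 - ε ≤ ρ ^ 2 - ρ) {u v : V} (huv : u ≠ v) :
    deficit G x u v ≤ Fintype.card V * (1 - x u) + ε :=
  (single_le_sum (f := deficit G x u)
    (fun _ hw => deficit_nonneg hG hx0 hx1 (ne_of_mem_erase hw).symm)
    (mem_erase.2 ⟨huv.symm, mem_univ v⟩)).trans (sum_deficit_le hx0 hx1 hε0 hx hρ u)

open Classical in
/-- Double counting: if `u` has exactly one common neighbour with every other vertex, then the
nonneighbours of `u` have no larger degree than `u`. -/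
lemma card_nbr_le_of_codeg (hG : ¬ (intersectingFourCycles 1).IsContained G) {u v : V}
    (hu : ∀ w, w ≠ u → (nbr G u ∩ nbr G w).card = 1) (hadj : ¬ G.Adj u v) :
    (nbr G v).card ≤ (nbr G u).card := by
  have h := sum_nbr_inter_comm (G := G) (nbr G v) (fun y => if G.Adj u y then 1 else 0)
  have e1 : ∑ w ∈ nbr G v, ∑ y ∈ nbr G w, (if G.Adj u y then (1 : ℝ) else 0) = (nbr G v).card := by
    rw [card_eq_sum_ones, Nat.cast_sum]
    refine sum_congr rfl fun w hw => ?_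
    have hwu : w ≠ u := fun h => hadj (by rw [← h]; exact (mem_nbr.1 hw).symm)
    rw [← hu w hwu, ← sum_filter, sum_const, nsmul_eq_mul, mul_one]
    congr 2
    ext y
    simp [and_comm]
  have e2 : ∑ y, ((nbr G y ∩ nbr G v).card : ℝ) * (if G.Adj u y then (1 : ℝ) else 0)
      ≤ (nbr G u).card := by
    simp only [mul_ite, mul_one, mul_zero]
    rw [← sum_filter]
    refine (sum_le_card_nsmul _ _ 1 fun y hy => ?_).trans ?_
    · have hyv : y ≠ v := fun h => hadj (by rw [← h]; exact (mem_filter.1 hy).2)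
      exact_mod_cast codeg_le_one hG hyv
    · simp [nbr]
  rw [e1] at h
  have := h.le.trans e2
  exact_mod_cast this

open Classical in
lemma sum_card_nbr_of_codeg {u : V} (hu : ∀ w, w ≠ u → (nbr G u ∩ nbr G w).card = 1) :
    ∑ w ∈ nbr G u, ((nbr G w).card : ℝ) = (nbr G u).card + (Fintype.card V - 1) := by
  have h := sum_nbr_inter_comm (G := G) (nbr G u) (fun _ => 1)
  simp only [mul_one, sum_const, nsmul_eq_mul] at h
  rw [h, ← sum_erase_add univ _ (mem_univ u), inter_self, add_comm]
  congr 1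
  rw [sum_congr rfl (g := fun _ => (1 : ℝ)) fun w hw => by
    rw [inter_comm, hu w (ne_of_mem_erase hw)]; simp]
  rw [sum_const, card_erase_of_mem (mem_univ u), card_univ, nsmul_eq_mul, mul_one, Nat.cast_sub
      (Fintype.card_pos_iff.2 ⟨u⟩)]
  simp

end FourCycleFree

/-! ### Four-cycle-free graphs: the maximum of the Perron vector -/

section FourCycleFreeStability

variable {V : Type*} [Fintype V] {G : SimpleGraph V}

open Classical in
/-- The vertices different from `z` and not adjacent to it. -/
noncomputable def nonNbr (G : SimpleGraph V) (z : V) : Finset V :=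
  univ.filter fun v => v ≠ z ∧ ¬ G.Adj z v

lemma mem_nonNbr {z v : V} : v ∈ nonNbr G z ↔ v ≠ z ∧ ¬ G.Adj z v := by simp [nonNbr]

lemma card_nbr_add_card_nonNbr (z : V) :
    ((nbr G z).card : ℝ) + (nonNbr G z).card + 1 = Fintype.card V := by
  classical
  have h1 : nonNbr G z = (insert z (nbr G z))ᶜ := by
    ext v; simp [mem_nonNbr]
  have h2 := card_compl_add_card (insert z (nbr G z))
  rw [← h1, card_insert_of_notMem (by simp)] at h2
  rw [← h2]; push_cast; ring

/-- At a maximum `z` of the Perron vector the deficits are small, so the nonneighbours of `z` have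
nearly maximal weight. -/
lemma sum_nonNbr_le (hG : ¬ (intersectingFourCycles 1).IsContained G) {ρ ε : ℝ} {x : V → ℝ}
    (hx0 : ∀ v, 0 ≤ x v) (hx1 : ∀ v, x v ≤ 1) (hε0 : 0 ≤ ε)
    (hx : ∀ u, ρ * x u = ∑ v ∈ nbr G u, x v)
    (hρ : (Fintype.card V : ℝ) - 1 - ε ≤ ρ ^ 2 - ρ) {z : V} (hz : x z = 1) :
    ∑ v ∈ nonNbr G z, (1 - x v) ≤ ε := by
  classical
  have h := sum_deficit_le (G := G) hx0 hx1 hε0 hx hρ z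
  rw [hz, sub_self, mul_zero, zero_add] at h
  refine le_trans ?_ h
  refine le_trans (sum_le_sum fun v hv => ?_) (sum_le_sum_of_subset_of_nonneg (fun v hv => ?_)
    fun v hv _ => deficit_nonneg hG hx0 hx1 (ne_of_mem_erase hv).symm)
  · exact le_deficit_of_not_adj hG hx0 (mem_nonNbr.1 hv).1.symm (mem_nonNbr.1 hv).2
  · exact mem_erase.2 ⟨(mem_nonNbr.1 hv).1, mem_univ v⟩

lemma le_of_mem_nonNbr {ε : ℝ} {x : V → ℝ} (hx1 : ∀ v, x v ≤ 1) {z : V}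
    (h : ∑ v ∈ nonNbr G z, (1 - x v) ≤ ε) {v : V} (hv : v ∈ nonNbr G z) : 1 - ε ≤ x v := by
  have := single_le_sum (f := fun v => 1 - x v) (fun v _ => sub_nonneg.2 (hx1 v)) hv
  linarith

open Classical in
/-- If the maximum `z` of the Perron vector is not adjacent to everything, then its nonneighbours
induce a four-cycle-free graph of minimum degree about `ρ`, hence there are nearly `n` of them. -/
lemma card_nbr_max_le (hG : ¬ (intersectingFourCycles 1).IsContained G) {ρ ε : ℝ} {x : V → ℝ}
    (hx0 : ∀ v, 0 ≤ x v) (hx1 : ∀ v, x v ≤ 1) (hε0 : 0 ≤ ε) (hρ1 : 100 ≤ ρ) (hε1 : ε * ρ ≤ 1)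
    (hx : ∀ u, ρ * x u = ∑ v ∈ nbr G u, x v)
    (hρ : (Fintype.card V : ℝ) - 1 - ε ≤ ρ ^ 2 - ρ) {z : V} (hz : x z = 1)
    (hne : (nonNbr G z).Nonempty) : ((nbr G z).card : ℝ) ≤ 4 * ρ := by
  have hsum := sum_nonNbr_le hG hx0 hx1 hε0 hx hρ hz
  set R := nonNbr G z with hR
  have hdeg : ∀ u ∈ R, ρ - 2 ≤ ((nbr G u ∩ R).card : ℝ) := by
    intro u hu
    have h1 := le_of_mem_nonNbr hx1 hsum hu
    have h2 : ρ * x u ≤ (nbr G u).card := by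
      rw [hx]
      refine (sum_le_card_nsmul _ _ 1 fun y _ => hx1 y).trans ?_
      simp
    have hu' := mem_nonNbr.1 hu
    have h3 : (nbr G u).card ≤ (nbr G u ∩ R).card + 1 := by
      refine le_trans (card_le_card (t := (nbr G u ∩ R) ∪ (nbr G u ∩ nbr G z)) fun v hv => ?_) ?_
      · rw [mem_union, mem_inter, mem_inter]
        by_cases hvz : G.Adj z v
        · exact Or.inr ⟨hv, mem_nbr.2 hvz⟩
        · exact Or.inl ⟨hv, mem_nonNbr.2
            ⟨fun h => hu'.2 (by rw [← h]; exact (mem_nbr.1 hv).symm), hvz⟩⟩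
      · refine (card_union_le _ _).trans ?_
        have := codeg_le_one hG hu'.1
        omega
    have h4 : ((nbr G u).card : ℝ) ≤ (nbr G u ∩ R).card + 1 := by exact_mod_cast h3
    nlinarith
  obtain ⟨u, hu⟩ := hne
  set W := nbr G u ∩ R with hW
  -- walks `u, w, y` inside `R` reach each `y ≠ u` at most once
  have hWR : (ρ - 2) * W.card ≤ R.card + W.card := by
    have h1 : (ρ - 2) * W.card ≤ ∑ w ∈ W, ((nbr G w ∩ R).card : ℝ) := by
      rw [mul_comm, ← nsmul_eq_mul]
      exact card_nsmul_le_sum _ _ _ fun w hw => hdeg w (mem_inter.1 hw).2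
    have h2 := sum_nbr_inter_comm (G := G) W (fun y => if y ∈ R then 1 else 0)
    have h3 : ∀ w, ∑ y ∈ nbr G w, (if y ∈ R then (1 : ℝ) else 0) = ((nbr G w ∩ R).card : ℝ) := by
      intro w
      rw [← sum_filter, sum_const, nsmul_eq_mul, mul_one, filter_mem_eq_inter]
    simp only [h3] at h2
    rw [h2] at h1
    refine h1.trans ?_
    simp only [mul_ite, mul_one, mul_zero]
    rw [← sum_filter, filter_mem_eq_inter, univ_inter, ← sum_erase_add R _ hu]
    refine add_le_add ?_ ?_
    · refine (sum_le_card_nsmul _ _ 1 fun y hy => ?_).trans ?_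
      · have h4 := codeg_le_one hG (ne_of_mem_erase hy)
        have h5 : (nbr G y ∩ W).card ≤ (nbr G y ∩ nbr G u).card :=
          card_le_card (inter_subset_inter_left inter_subset_left)
        exact_mod_cast h5.trans h4
      · rw [nsmul_eq_mul, mul_one]
        exact_mod_cast card_le_card (erase_subset u R)
    · exact_mod_cast card_le_card inter_subset_right
  have h1 := hdeg u hu
  have h2 : (ρ - 3) * (ρ - 2) ≤ R.card := by nlinarith
  have h3 := card_nbr_add_card_nonNbr (G := G) z
  have h4 : ε ≤ 1 := by nlinarith
  nlinarith

open Classical in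
/-- If the maximum `z` of the Perron vector is not adjacent to everything, then the Perron vector
is nearly constant: a vertex of small weight would cause a deficit at almost every vertex. -/
lemma perron_nearly_constant (hG : ¬ (intersectingFourCycles 1).IsContained G) {ρ ε : ℝ}
    {x : V → ℝ} (hx0 : ∀ v, 0 ≤ x v) (hx1 : ∀ v, x v ≤ 1) (hε0 : 0 ≤ ε) (hρ1 : 100 ≤ ρ)
    (hε1 : ε * ρ ≤ 1) (hx : ∀ u, ρ * x u = ∑ v ∈ nbr G u, x v)
    (hρ : (Fintype.card V : ℝ) - 1 - ε ≤ ρ ^ 2 - ρ) (hρ' : ρ ^ 2 - ρ ≤ Fintype.card V - 1)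
    {z : V} (hz : x z = 1) (hne : (nonNbr G z).Nonempty) (v : V) : 1 - 3 / ρ ≤ x v := by
  have hsum := sum_nonNbr_le hG hx0 hx1 hε0 hx hρ hz
  have hcz := card_nbr_max_le hG hx0 hx1 hε0 hρ1 hε1 hx hρ hz hne
  have hnz := card_nbr_add_card_nonNbr (G := G) z
  have hρ0 : 0 < ρ := by linarith
  have hερ : ε ≤ 1 / ρ := by rw [le_div_iff₀ hρ0]; exact hε1
  have hε2 : ε ≤ 1 / 2 := by nlinarith
  set n : ℝ := ((Fintype.card V : ℕ) : ℝ) with hn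
  set R := nonNbr G z with hR
  by_contra hlt
  push Not at hlt
  have hd : ((nbr G v ∩ R).card : ℝ) ≤ 2 * ρ := by
    have h1 : ((nbr G v ∩ R).card : ℝ) * (1 / 2) ≤ ∑ y ∈ nbr G v ∩ R, x y := by
      rw [← nsmul_eq_mul]
      refine card_nsmul_le_sum _ _ _ fun y hy => ?_
      have := le_of_mem_nonNbr hx1 hsum (mem_inter.1 hy).2
      linarith
    have h2 : ∑ y ∈ nbr G v ∩ R, x y ≤ ρ * x v := by
      rw [hx]
      exact sum_le_sum_of_subset_of_nonneg inter_subset_left fun y _ _ => hx0 y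
    nlinarith [hx1 v]
  have hvR : v ∉ R := fun h => by
    have h1 := le_of_mem_nonNbr hx1 hsum h
    have h2 : 1 / ρ ≤ 3 / ρ := by gcongr; norm_num
    linarith
  have hR' : ((R \ nbr G v).card : ℝ) * (2 / ρ) ≤ n * ε := by
    calc ((R \ nbr G v).card : ℝ) * (2 / ρ) ≤ ∑ u ∈ R \ nbr G v, n * (1 - x u) := by
          rw [← nsmul_eq_mul]
          refine card_nsmul_le_sum _ _ _ fun u hu => ?_
          have hu' := mem_sdiff.1 hu
          have huv : u ≠ v := fun h => hvR (h ▸ hu'.1)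
          have hadj : ¬ G.Adj u v := fun h => hu'.2 (mem_nbr.2 h.symm)
          have h1 := deficit_le hG hx0 hx1 hε0 hx hρ huv
          have h2 := le_deficit_of_not_adj hG hx0 huv hadj
          have h3 : 3 / ρ = 2 / ρ + 1 / ρ := by ring
          linarith
      _ = n * ∑ u ∈ R \ nbr G v, (1 - x u) := by rw [mul_sum]
      _ ≤ n * ε := by
          refine mul_le_mul_of_nonneg_left (le_trans ?_ hsum) (by positivity)
          exact sum_le_sum_of_subset_of_nonneg sdiff_subset fun u _ _ => sub_nonneg.2 (hx1 u)
  have hR2 : ((R \ nbr G v).card : ℝ) * 2 ≤ n := by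
    have h1 : n * ε ≤ n * (1 / ρ) := by gcongr
    have h2 := mul_le_mul_of_nonneg_right (hR'.trans h1) hρ0.le
    have e1 : ((R \ nbr G v).card : ℝ) * (2 / ρ) * ρ = ((R \ nbr G v).card : ℝ) * 2 := by field_simp
    have e2 : n * (1 / ρ) * ρ = n := by field_simp
    linarith
  have hR3 : (R.card : ℝ) = ((R \ nbr G v).card : ℝ) + ((nbr G v ∩ R).card : ℝ) := by
    have := card_sdiff_add_card_inter R (nbr G v)
    rw [inter_comm] at this
    exact_mod_cast this.symm
  nlinarith

open Classical in
/-- The maximum of the Perron vector of a four-cycle-free graph with `ρ² - ρ ≥ n - 1 - ε` is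
adjacent to all other vertices. Otherwise the Perron vector is nearly constant, and almost all
vertices (the good ones) have exactly one common neighbour with every other vertex. They all have
the maximum degree `d`, and the degrees of the neighbours of a good vertex fall short of `d` by `m =
d (d - 1) - (n - 1)` in total. If `m ≥ 1`, then the average degree is too small for `ρ`; if `m = 0`,
then `n` is odd, the graph is regular, and the friendship theorem applies. -/
lemma nonNbr_max_eq_empty (hG : ¬ (intersectingFourCycles 1).IsContained G) {ρ ε : ℝ}
    {x : V → ℝ} (hx0 : ∀ v, 0 ≤ x v) (hx1 : ∀ v, x v ≤ 1) (hε0 : 0 ≤ ε) (hρ1 : 100 ≤ ρ)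
    (hε1 : ε * ρ ≤ 1) (hodd : Odd (Fintype.card V) → ε = 0)
    (hx : ∀ u, ρ * x u = ∑ v ∈ nbr G u, x v)
    (hρ : (Fintype.card V : ℝ) - 1 - ε ≤ ρ ^ 2 - ρ) {z : V} (hz : x z = 1) :
    nonNbr G z = ∅ := by
  by_contra hne
  rw [← ne_eq, ← nonempty_iff_ne_empty] at hne
  have hρ' : ρ ^ 2 - ρ ≤ Fintype.card V - 1 := by
    have h1 := sum_deficit_eq (G := G) hx z
    rw [hz, sub_self, mul_zero, sub_zero, mul_one] at h1
    have h2 : 0 ≤ ∑ v ∈ univ.erase z, deficit G x z v :=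
      sum_nonneg fun v hv => deficit_nonneg hG hx0 hx1 (ne_of_mem_erase hv).symm
    linarith
  have hconst := perron_nearly_constant hG hx0 hx1 hε0 hρ1 hε1 hx hρ hρ' hz hne
  have hsum := sum_nonNbr_le hG hx0 hx1 hε0 hx hρ hz
  have hcz := card_nbr_max_le hG hx0 hx1 hε0 hρ1 hε1 hx hρ hz hne
  have hρ0 : 0 < ρ := by linarith
  have hερ : ε ≤ 1 / ρ := by rw [le_div_iff₀ hρ0]; exact hε1
  have hinv : 1 / ρ ≤ 1 / 100 := by gcongr
  have h3inv : 3 / ρ = 3 * (1 / ρ) := by ring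
  set θ := 1 / ρ with hθ
  have hθρ : θ * ρ = 1 := by rw [hθ]; field_simp
  have hθ0 : 0 < θ := by rw [hθ]; positivity
  rw [h3inv] at hconst
  set n : ℝ := ((Fintype.card V : ℕ) : ℝ) with hn
  have hnρ : n ≤ ρ ^ 2 := by nlinarith
  have hnρ2 : ρ ^ 2 - ρ ≤ n := by linarith
  have hnbig : 99 * ρ ≤ n := by nlinarith
  set good : Finset V := univ.filter fun u => n * (1 - x u) ≤ 1 / 2 with hgood
  have hcodeg : ∀ u ∈ good, ∀ v, v ≠ u → (nbr G u ∩ nbr G v).card = 1 := by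
    intro u hu v hvu
    refine codeg_eq_one_of_deficit_lt hG hx1 hvu.symm ?_
    have h1 := deficit_le hG hx0 hx1 hε0 hx hρ hvu.symm
    have h2 := (mem_filter.1 hu).2
    have h3 := hconst v
    linarith
  have hzgood : z ∈ good := mem_filter.2 ⟨mem_univ z, by rw [hz]; norm_num⟩
  have hbad : ((goodᶜ).card : ℝ) ≤ 6 * ρ := by
    have h1 : goodᶜ ⊆ nbr G z ∪ (nonNbr G z).filter (fun u => ¬ n * (1 - x u) ≤ 1 / 2) := by
      intro u hu
      have hu' : ¬ n * (1 - x u) ≤ 1 / 2 := fun h => (mem_compl.1 hu) (mem_filter.2 ⟨mem_univ u, h⟩)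
      rw [mem_union, mem_filter, mem_nonNbr, mem_nbr]
      by_cases h : G.Adj z u
      · exact Or.inl h
      · exact Or.inr ⟨⟨fun h' => mem_compl.1 hu (h' ▸ hzgood), h⟩, hu'⟩
    have h2 : (((nonNbr G z).filter (fun u => ¬ n * (1 - x u) ≤ 1 / 2)).card : ℝ) * (1 / 2)
        ≤ n * ε := by
      calc _ ≤ ∑ u ∈ (nonNbr G z).filter (fun u => ¬ n * (1 - x u) ≤ 1 / 2), n * (1 - x u) := by
            rw [← nsmul_eq_mul]
            exact card_nsmul_le_sum _ _ _ fun u hu => (not_le.1 (mem_filter.1 hu).2).le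
        _ = n * ∑ u ∈ (nonNbr G z).filter (fun u => ¬ n * (1 - x u) ≤ 1 / 2), (1 - x u) := by
            rw [mul_sum]
        _ ≤ n * ε := by
            refine mul_le_mul_of_nonneg_left (le_trans ?_ hsum) (by positivity)
            exact sum_le_sum_of_subset_of_nonneg (filter_subset _ _)
              fun u _ _ => sub_nonneg.2 (hx1 u)
    have h3 : n * ε ≤ ρ ^ 2 * θ := by gcongr
    have h4 : ρ ^ 2 * θ = ρ := by linear_combination ρ * hθρ
    have h5 : ((goodᶜ).card : ℝ) ≤ (nbr G z).card
        + ((nonNbr G z).filter (fun u => ¬ n * (1 - x u) ≤ 1 / 2)).card := by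
      exact_mod_cast (card_le_card h1).trans (card_union_le _ _)
    linarith
  have hdegρ : ∀ v, ((nbr G v).card : ℝ) * (1 - 3 * θ) ≤ ρ := by
    intro v
    have h1 : ((nbr G v).card : ℝ) * (1 - 3 * θ) ≤ ρ * x v := by
      rw [hx, ← nsmul_eq_mul]
      exact card_nsmul_le_sum _ _ _ fun y _ => hconst y
    nlinarith [hx1 v]
  have hdeg2 : ∀ v, ((nbr G v).card : ℝ) ≤ 2 * ρ := fun v => by
    have h1 := hdegρ v
    have h2 : (0 : ℝ) ≤ (nbr G v).card := by positivity
    nlinarith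
  have hpick : ∀ v v', ∃ u ∈ good, ¬ G.Adj u v ∧ ¬ G.Adj u v' := by
    intro v v'
    by_contra! hcon
    have h1 : (univ : Finset V) ⊆ goodᶜ ∪ (nbr G v ∪ nbr G v') := by
      intro u _
      simp only [mem_union, mem_compl, mem_nbr]
      by_cases hu : u ∈ good
      · by_cases h : G.Adj u v
        · exact Or.inr (Or.inl h.symm)
        · exact Or.inr (Or.inr (hcon u hu h).symm)
      · exact Or.inl hu
    have h2 : Fintype.card V ≤ (goodᶜ).card + ((nbr G v).card + (nbr G v').card) := by
      rw [← card_univ]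
      refine (card_le_card h1).trans ((card_union_le _ _).trans ?_)
      gcongr
      exact card_union_le _ _
    have h3 : n ≤ (goodᶜ).card + (((nbr G v).card : ℝ) + (nbr G v').card) := by
      rw [hn]; exact_mod_cast h2
    linarith [hdeg2 v, hdeg2 v']
  have hmaxdeg : ∀ u' ∈ good, ∀ v, (nbr G v).card ≤ (nbr G u').card := by
    intro u' hu' v
    obtain ⟨u, hu, h1, h2⟩ := hpick v u'
    exact (card_nbr_le_of_codeg hG (hcodeg u hu) h1).trans
      (card_nbr_le_of_codeg hG (hcodeg u' hu') fun h => h2 h.symm)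
  set d := (nbr G z).card with hd
  have hdmax : ∀ v, (nbr G v).card ≤ d := hmaxdeg z hzgood
  have hdgood : ∀ u ∈ good, (nbr G u).card = d := fun u hu =>
    le_antisymm (hdmax u) (hmaxdeg u hu z)
  have hdmaxr : ∀ v, ((nbr G v).card : ℝ) ≤ d := fun v => by exact_mod_cast hdmax v
  have hshort : ∀ u ∈ good, ∑ w ∈ nbr G u, ((d : ℝ) - (nbr G w).card) = d * d - d - (n - 1) := by
    intro u hu
    rw [sum_sub_distrib, sum_card_nbr_of_codeg (hcodeg u hu), sum_const, hdgood u hu, nsmul_eq_mul]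
    ring
  set m : ℝ := d * d - d - (n - 1) with hm
  have hm0 : 0 ≤ m := by
    rw [← hshort z hzgood]
    exact sum_nonneg fun w _ => sub_nonneg.2 (hdmaxr w)
  have hρd : ρ ≤ d := by
    have h1 : ρ * x z ≤ d := by
      rw [hx]
      refine (sum_le_card_nsmul _ _ 1 fun y _ => hx1 y).trans ?_
      simp [hd]
    rwa [hz, mul_one] at h1
  by_cases hcase : d + (Fintype.card V - 1) = d * d
  · have hVpos : 1 ≤ Fintype.card V := Fintype.card_pos_iff.2 ⟨z⟩
    have hdd : Fintype.card V = d * (d - 1) + 1 := by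
      have h1 : d * (d - 1) + d = d * d := by
        rcases d with _ | d
        · simp
        · simp; ring
      omega
    have hodd' : Odd (Fintype.card V) := by
      rw [hdd]
      exact (Nat.even_mul_pred_self d).add_one
    have hε := hodd hodd'
    have hm' : m = 0 := by
      have : ((d + (Fintype.card V - 1) : ℕ) : ℝ) = ((d * d : ℕ) : ℝ) := by rw [hcase]
      push_cast [Nat.cast_sub hVpos] at this
      rw [hm, hn]; linarith
    have hdρ : (d : ℝ) = ρ := by
      refine le_antisymm ?_ hρd
      nlinarith
    have hx1' : ∀ v, x v = 1 := by
      intro v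
      refine le_antisymm (hx1 v) ?_
      by_cases hvz : v = z
      · rw [hvz, hz]
      by_cases hadj : G.Adj z v
      · have h1 : ∑ y ∈ nbr G z, (1 - x y) = 0 := by
          rw [sum_sub_distrib, ← hx, hz, sum_const, nsmul_eq_mul, mul_one, mul_one, ← hdρ]
          simp [hd]
        have h2 := (sum_eq_zero_iff_of_nonneg fun y _ => sub_nonneg.2 (hx1 y)).1 h1 v
          (mem_nbr.2 hadj)
        linarith
      · have := le_of_mem_nonNbr hx1 hsum (mem_nonNbr.2 ⟨hvz, hadj⟩)
        linarith
    have hall : ∀ v, v ∈ good := fun v => mem_filter.2 ⟨mem_univ v, by rw [hx1' v]; norm_num⟩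
    have hd3 : 3 ≤ d := by
      have : (3 : ℝ) ≤ d := by linarith
      exact_mod_cast this
    exact not_friendship_of_regular hd3 (fun v => hdgood v (hall v))
      (fun u v huv => hcodeg u (hall u) v huv.symm) hdd
  · have hVpos : 1 ≤ Fintype.card V := Fintype.card_pos_iff.2 ⟨z⟩
    have hm1 : 1 ≤ m := by
      have h1 : d + (Fintype.card V - 1) ≤ d * d := by
        have : ((d + (Fintype.card V - 1) : ℕ) : ℝ) ≤ ((d * d : ℕ) : ℝ) := by
          push_cast [Nat.cast_sub hVpos]
          linarith
        exact_mod_cast this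
      have h2 : d + (Fintype.card V - 1) + 1 ≤ d * d := by omega
      have h3 : ((d + (Fintype.card V - 1) + 1 : ℕ) : ℝ) ≤ ((d * d : ℕ) : ℝ) := by
        exact_mod_cast h2
      push_cast [Nat.cast_sub hVpos] at h3
      rw [hm, hn]; linarith
    -- the total degree shortfall, counted from the good vertices
    set f : V → ℝ := fun w => (d : ℝ) - (nbr G w).card with hf
    have hf0 : ∀ w, 0 ≤ f w := fun w => sub_nonneg.2 (hdmaxr w)
    have hF : m * (n - 6 * ρ) ≤ d * ∑ w, f w := by
      have h1 : m * good.card ≤ ∑ u, ∑ w ∈ nbr G u, f w := by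
        calc m * good.card = ∑ u ∈ good, ∑ w ∈ nbr G u, f w := by
              rw [sum_congr rfl hshort, sum_const, nsmul_eq_mul, mul_comm]
          _ ≤ _ := sum_le_sum_of_subset_of_nonneg (subset_univ _)
              fun u _ _ => sum_nonneg fun w _ => hf0 w
      have h2 : ∑ u, ∑ w ∈ nbr G u, f w ≤ d * ∑ w, f w := by
        rw [sum_nbr_inter_comm, mul_sum]
        refine sum_le_sum fun w _ => mul_le_mul_of_nonneg_right ?_ (hf0 w)
        rw [inter_univ]; exact hdmaxr w
      have h3 : n - 6 * ρ ≤ good.card := by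
        have := card_compl_add_card good
        have h4 : ((goodᶜ).card : ℝ) + good.card = n := by rw [hn]; exact_mod_cast this
        linarith
      have h4 : m * (n - 6 * ρ) ≤ m * good.card := by gcongr
      linarith
    have hF0 : 0 ≤ ∑ w, f w := sum_nonneg fun w _ => hf0 w
    -- the shortfall bounds `ρ` away from `d`
    have hgap : (1 - 3 * θ) * ∑ w, f w ≤ (d - ρ) * n := by
      have h1 : ρ * ∑ u, x u = ∑ u, ((nbr G u).card : ℝ) * x u := by
        rw [mul_sum, sum_congr rfl fun u _ => hx u, sum_nbr_inter_comm]
        simp only [inter_univ]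
      have h2 : ∑ w, f w * x w = (d - ρ) * ∑ u, x u := by
        rw [sub_mul, h1, mul_sum, ← sum_sub_distrib]
        exact sum_congr rfl fun w _ => by simp only [hf]; ring
      have h3 : (1 - 3 * θ) * ∑ w, f w ≤ ∑ w, f w * x w := by
        rw [mul_sum]
        refine sum_le_sum fun w _ => ?_
        rw [mul_comm]
        exact mul_le_mul_of_nonneg_left (hconst w) (hf0 w)
      have h4 : ∑ u, x u ≤ n := by
        refine (sum_le_card_nsmul _ _ 1 fun y _ => hx1 y).trans ?_
        simp [hn]
      have h5 : (d - ρ) * ∑ u, x u ≤ (d - ρ) * n := by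
        apply mul_le_mul_of_nonneg_left h4
        linarith
      linarith
    have hA : 0.97 * (m * (n - 6 * ρ)) ≤ d * ((d - ρ) * n) := by
      have h1 : 0.97 * ∑ w, f w ≤ (1 - 3 * θ) * ∑ w, f w := by
        apply mul_le_mul_of_nonneg_right _ hF0
        linarith
      have h2 : (0 : ℝ) ≤ d := by positivity
      have h3 := mul_le_mul_of_nonneg_left (h1.trans hgap) h2
      linarith
    have hB : (d - ρ) * (d + ρ - 1) ≤ 1.01 * m := by
      have h1 : (d - ρ) * (d + ρ - 1) = m + (n - 1) - (ρ ^ 2 - ρ) := by rw [hm]; ring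
      rw [h1]
      linarith
    have hC : 1.9 * (d : ℝ) ≤ d + ρ - 1 := by
      have h1 := hdegρ z
      have h2 : (0 : ℝ) ≤ d := by positivity
      have h3 : (d : ℝ) * 0.97 ≤ ρ := by
        refine le_trans (mul_le_mul_of_nonneg_left ?_ h2) h1
        linarith
      linarith
    have hD : 1.9 * (d * ((d - ρ) * n)) ≤ 1.01 * m * n := by
      have h1 : 0 ≤ (d - ρ) := by linarith
      have hn0 : 0 ≤ n := by linarith
      have h2 := mul_le_mul_of_nonneg_left hC h1
      have h3 := mul_le_mul_of_nonneg_right (h2.trans hB) hn0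
      linarith
    have hE : m * (6 * ρ) ≤ m * (n * 0.1) := by
      apply mul_le_mul_of_nonneg_left _ hm0
      linarith
    have hmn : 0 < m * n := by
      apply mul_pos <;> linarith
    linarith

end FourCycleFreeStability

/-! ### The two cases combined -/

section Main

variable {V : Type*} [Fintype V] {G : SimpleGraph V}

open Classical in
lemma nonempty_iso_extremalGraph_one (hG : ¬ (intersectingFourCycles 1).IsContained G) {n : ℕ}
    (hcard : Fintype.card V = n) (hn : 10001 ≤ n) (hrho : rho (extremalGraph n 1) ≤ rho G) :
    Nonempty (G ≃g extremalGraph n 1) := by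
  have : Nonempty V := Fintype.card_pos_iff.1 (by omega)
  obtain ⟨hρ0, -, -, x, hx0, hx1, ⟨z, hz⟩, hx⟩ := exists_perron G
  have : Nonempty (Fin 1 ⊕ Fin (n - 1)) := ⟨Sum.inl 0⟩
  have hF0 := (exists_perron (extremalGraph n 1)).1
  have hFsq := le_rho_extremalGraph_sq (n := n) le_rfl (by omega)
  have hnr : (10001 : ℝ) ≤ n := by exact_mod_cast hn
  obtain ⟨γ, hγ1, hγodd, hγ⟩ := le_rho_extremalGraph_one (n := n) (by omega)
  set σ := rho (extremalGraph n 1) with hσ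
  set ρ := rho G with hρ
  have hσ100 : 100 ≤ σ := by
    refine le_of_sq_le_sq ?_ hF0
    push_cast at hFsq
    linarith
  have hρ100 : 100 ≤ ρ := hσ100.trans hrho
  have hγr : (γ : ℝ) ≤ 1 := by exact_mod_cast hγ1
  have hγ0 : (0 : ℝ) ≤ γ := by positivity
  have hempty := nonNbr_max_eq_empty hG (ε := γ / ρ) hx0 hx1 (by positivity) hρ100
    (by rw [div_mul_cancel₀ _ (by linarith)]; exact hγr)
    (fun hodd => by rw [hcard] at hodd; rw [hγodd hodd]; simp) hx (by
      rw [hcard]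
      -- `ρ ^ 2 - ρ + γ / ρ` is increasing in `ρ`
      have h1 : γ / σ - γ / ρ = γ * (ρ - σ) / (σ * ρ) := by
        field_simp
      have h2 : γ * (ρ - σ) / (σ * ρ) ≤ ρ - σ := by
        rw [div_le_iff₀ (by positivity)]
        have h3 : 0 ≤ ρ - σ := by linarith
        have h4 : γ ≤ σ * ρ := by nlinarith
        nlinarith
      nlinarith) hz
  refine nonempty_iso_of_large_vertices hG le_rfl hcard (by omega) hrho hx0 hx1 hx (L := {z})
    (card_singleton z) (fun l hl => by rw [mem_singleton.1 hl, hz]; norm_num) fun l hl => ?_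
  have h1 : (nbr G l)ᶜ ⊆ {z} := fun v hv => by
    rw [mem_singleton.1 hl, mem_compl, mem_nbr] at hv
    by_contra hvz
    have h2 : v ∈ nonNbr G z := mem_nonNbr.2 ⟨fun h => hvz (mem_singleton.2 h), hv⟩
    rw [hempty] at h2
    exact notMem_empty v h2
  have h2 := card_le_card h1
  rw [card_singleton] at h2
  omega

lemma exists_nonempty_iso_extremalGraph {t : ℕ} (ht : 2 ≤ t) :
    ∃ N : ℕ, ∀ n : ℕ, N ≤ n → ∀ (V : Type*) [Fintype V] (G : SimpleGraph V), Fintype.card V = n →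
      rho (extremalGraph n t) ≤ rho G → ¬ (intersectingFourCycles t).IsContained G →
      Nonempty (G ≃g extremalGraph n t) := by
  classical
  have htr : (2 : ℝ) ≤ t := by exact_mod_cast ht
  set c : ℝ := 64 * t * (7 * t + 3) with hc
  have hc1 : 1 ≤ c := by rw [hc]; nlinarith
  set ε : ℝ := 1 / (2 * c) with hε
  have hε0 : 0 < ε := by rw [hε]; positivity
  have hε1 : ε ≤ 1 / 2 := by rw [hε]; gcongr; linarith
  set δ : ℝ := ε / (20 * t + 11) with hδ
  have hδ0 : 0 < δ := by rw [hδ]; positivity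
  set K : ℕ := ⌈((t : ℝ) + 1) / δ⌉₊ with hK
  set C : ℝ := (K : ℝ) * (2 ^ K * (3 * t + 1)) with hC
  have hC0 : 0 ≤ C := by rw [hC]; positivity
  set B : ℝ := C / δ + (C + 1) + (6 * t + 3) / δ ^ 2 + (t : ℝ) ^ 2 / δ + 2 * (t : ℝ) ^ 2
    + 2 * (32 * (t : ℝ) ^ 2) ^ 2 with hB
  refine ⟨⌈B⌉₊, fun n hn V _ G hcard hrho hG => ?_⟩
  have hBn : B ≤ n := (Nat.le_ceil B).trans (by exact_mod_cast hn)
  have p1 : 0 ≤ C / δ := by positivity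
  have p2 : 0 ≤ (6 * (t : ℝ) + 3) / δ ^ 2 := by positivity
  have p3 : 0 ≤ (t : ℝ) ^ 2 / δ := by positivity
  have p4 : 0 ≤ 2 * (t : ℝ) ^ 2 := by positivity
  have p5 : 0 ≤ 2 * (32 * (t : ℝ) ^ 2) ^ 2 := by positivity
  have hn1 : C ≤ δ * n := by
    have : C / δ ≤ n := by linarith
    rw [div_le_iff₀ hδ0] at this
    linarith
  have hn3 : 6 * (t : ℝ) + 3 ≤ δ ^ 2 * n := by
    have : (6 * (t : ℝ) + 3) / δ ^ 2 ≤ n := by linarith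
    rw [div_le_iff₀ (by positivity)] at this
    linarith
  have hn4 : (t : ℝ) ^ 2 ≤ δ * n := by
    have : (t : ℝ) ^ 2 / δ ≤ n := by linarith
    rw [div_le_iff₀ hδ0] at this
    linarith
  have hn6 : 2 * (32 * t ^ 2) ^ 2 ≤ n := by
    have : 2 * (32 * (t : ℝ) ^ 2) ^ 2 ≤ n := by linarith
    exact_mod_cast this
  have htn : t ≤ n := by
    refine le_trans ?_ hn6
    nlinarith [Nat.pow_le_pow_left ht 2, Nat.pow_le_pow_left ht 4]
  have : Nonempty V := Fintype.card_pos_iff.1 (by omega)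
  obtain ⟨hρ0, -, -, x, hx0, hx1, ⟨z, hz⟩, hx⟩ := exists_perron G
  have : Nonempty (Fin t ⊕ Fin (n - t)) := ⟨Sum.inl ⟨0, by omega⟩⟩
  have hF0 := (exists_perron (extremalGraph n t)).1
  have hsq := (le_rho_extremalGraph_sq (by omega) htn).trans (pow_le_pow_left₀ hF0 hrho 2)
  subst hcard
  obtain ⟨L, hL, hLx⟩ := exists_large_vertices ht hG hρ0 hsq hx0 hx1 hx hz (ε := ε) (δ := δ)
    (K := K) hε1 hδ0 (by rw [hδ]; field_simp; exact le_rfl)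
    (by rw [← div_le_iff₀ hδ0]; exact Nat.le_ceil _) hn1 (by linarith) hn3 hn4 (by linarith)
  refine nonempty_iso_of_large_vertices hG (by omega) rfl hn6 hrho hx0 hx1 hx hL
    (fun l hl => (hLx l hl).1) fun l hl => ?_
  have h1 := (hLx l hl).2
  have h2 : c * ((nbr G l)ᶜ.card : ℝ) ≤ Fintype.card V := by
    have h3 := mul_le_mul_of_nonneg_left h1 (by linarith : 0 ≤ c)
    have h4 : c * (2 * ε * Fintype.card V) = Fintype.card V := by
      rw [hε]; field_simp
    linarith
  rw [hc] at h2
  exact_mod_cast h2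

lemma rho_le_rho [Nonempty V] {W : Type*} [Fintype W] [Nonempty W] {H : SimpleGraph W}
    (h : adjSpectralRadius H ≤ adjSpectralRadius G) : rho H ≤ rho G := by
  obtain ⟨h0, h1, -⟩ := exists_perron G
  rw [h1, (exists_perron H).2.1] at h
  exact (ENNReal.ofReal_le_ofReal_iff h0).1 h

end Main

end SpectralTuran


theorem theorem1p5 (t : ℕ) (ht : 1 ≤ t) :
    ∃ N : ℕ, ∀ n : ℕ, N ≤ n →
      ¬ (SpectralTuran.intersectingFourCycles t).IsContained (SpectralTuran.extremalGraph n t) ∧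
      ∀ (V : Type*) [Fintype V] (G : SimpleGraph V), Fintype.card V = n →
        SpectralTuran.adjSpectralRadius (SpectralTuran.extremalGraph n t) ≤ SpectralTuran.adjSpectralRadius G →
        ¬ Nonempty (G ≃g SpectralTuran.extremalGraph n t) →
        (SpectralTuran.intersectingFourCycles t).IsContained G := by
  obtain ⟨N, hN⟩ : ∃ N : ℕ, ∀ n : ℕ, N ≤ n → ∀ (V : Type _) [Fintype V] (G : SimpleGraph V),
      Fintype.card V = n →
      SpectralTuran.rho (SpectralTuran.extremalGraph n t) ≤ SpectralTuran.rho G →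
      ¬ (SpectralTuran.intersectingFourCycles t).IsContained G →
      Nonempty (G ≃g SpectralTuran.extremalGraph n t) := by
    rcases ht.eq_or_lt with rfl | ht2
    · exact ⟨10001, fun n hn V _ G hcard hrho hG =>
        SpectralTuran.nonempty_iso_extremalGraph_one hG hcard hn hrho⟩
    · exact SpectralTuran.exists_nonempty_iso_extremalGraph ht2
  refine ⟨max N 1, fun n hn => ⟨SpectralTuran.not_isContained_extremalGraph ht,
    fun V _ G hcard hrho hiso => ?_⟩⟩
  by_contra hG
  have : Nonempty V := Fintype.card_pos_iff.1 (by
    rw [hcard]; exact lt_of_lt_of_le one_pos ((le_max_right N 1).trans hn))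
  have : Nonempty (Fin t ⊕ Fin (n - t)) := ⟨Sum.inl ⟨0, ht⟩⟩
  exact hiso (hN n ((le_max_left N 1).trans hn) V G hcard (SpectralTuran.rho_le_rho hrho) hG)
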